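/- A \emph{monadic MV-algebra} is an algebra $\langle \mathbf{A},\exists,\forall\rangle$, where $\mathbf{A}=(A,\oplus,\neg,0)$ is an MV-algebra and $\exists,\forall$ are unary operations on $A$ satisfying the identities \[ \forall x\to x\approx 1,\quad \forall(x\to\forall y)\approx \exists x\to\forall y,\quad \forall(\forall x\to y)\approx\forall x\to\forall y,\quad \forall(\exists x\vee y)\approx\exists x\vee\forall y,\quad \exists(x*x)\approx\exists x*\exists x, \] where $1=\neg 0$, $x\to y=\neg x\oplus y$, $x*y=\neg(\neg x\oplus\neg y)$, $x\vee y=(x\to y)\to y$ and $x\wedge y=x*(x\to y)$. Let $\mathbb{MMV}$ be the variety of monadic MV-algebras, and let $\mathbb{MMV}_{\mathrm{FSI}}$ be the class of its finitely subdirectly irreducible members, i.e. those algebras in which the intersection of two congruences is the identity relation only if one of the two is the identity relation. A class $\mathbb{K}$ of such algebras has the \emph{finite embeddability property} if for every $\mathbf{A}\in\mathbb{K}$ and every finite subset $S\subseteq A$ there are a finite algebra $\mathbf{B}\in\mathbb{K}$ and an injective map $h\colon S\to B$ that preserves each of the operations $0,1,\neg,\oplus,*,\to,\vee,\wedge,\exists,\forall$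 whenever the arguments and the value of the operation all lie in $S$. \textbf{Theorem.} The class $\mathbb{MMV}_{\mathrm{FSI}}$ has the finite embeddability property, and so does the variety $\mathbb{MMV}$. -/

import Mathlib

universe u

/-- An MV-algebra `(A, ⊕, ¬, 0)`. -/
class MVAlgebra (A : Type u) where
  oplus : A → A → A
  neg : A → A
  zero : A
  oplus_assoc : ∀ x y z : A, oplus (oplus x y) z = oplus x (oplus y z)
  oplus_comm : ∀ x y : A, oplus x y = oplus y x
  oplus_zero : ∀ x : A, oplus x zero = x
  neg_neg : ∀ x : A, neg (neg x) = x
  oplus_neg_zero : ∀ x : A, oplus x (neg zero) = neg zero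
  luk : ∀ x y : A, oplus (neg (oplus (neg x) y)) y = oplus (neg (oplus (neg y) x)) x

namespace MVAlgebra

variable {A : Type u} [MVAlgebra A]

/-- The top element `1 = ¬0`. -/
def one : A := neg zero

/-- The product `x * y = ¬(¬x ⊕ ¬y)`. -/
def prod (x y : A) : A := neg (oplus (neg x) (neg y))

/-- The implication `x → y = ¬x ⊕ y`. -/
def imp (x y : A) : A := oplus (neg x) y

/-- The join `x ∨ y = (x → y) → y`. -/
def join (x y : A) : A := imp (imp x y) y

/-- The meet `x ∧ y = x * (x → y)`. -/
def meet (x y : A) : A := prod x (imp x y)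

end MVAlgebra

open MVAlgebra in
/-- A monadic MV-algebra: an MV-algebra with two unary operations `∃` (`ex`) and
`∀` (`all`) satisfying the identities (M1)-(M5). -/
class MonadicMVAlgebra (A : Type u) extends MVAlgebra A where
  ex : A → A
  all : A → A
  all_imp_self : ∀ x : A, imp (all x) x = one
  all_imp_all : ∀ x y : A, all (imp x (all y)) = imp (ex x) (all y)
  all_all_imp : ∀ x y : A, all (imp (all x) y) = imp (all x) (all y)
  all_ex_join : ∀ x y : A, all (join (ex x) y) = join (ex x) (all y)
  ex_prod_self : ∀ x : A, ex (prod x x) = prod (ex x) (ex x)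

namespace MonadicMVAlgebra

open MVAlgebra

/-- A congruence of a monadic MV-algebra: an equivalence relation compatible with the
fundamental operations (hence also with the derived ones). -/
structure Congruence (A : Type u) [MonadicMVAlgebra A] extends Setoid A where
  oplus_congr : ∀ {a b c d : A}, r a b → r c d → r (oplus a c) (oplus b d)
  neg_congr : ∀ {a b : A}, r a b → r (neg a) (neg b)
  ex_congr : ∀ {a b : A}, r a b → r (ex a) (ex b)
  all_congr : ∀ {a b : A}, r a b → r (all a) (all b)

/-- `A` is finitely subdirectly irreducible: the identity relation is finitely
meet-irreducible in the lattice of congruences of `A`. -/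
def IsFSI (A : Type u) [MonadicMVAlgebra A] : Prop :=
  ∀ θ ψ : Congruence A, θ.toSetoid ⊓ ψ.toSetoid = ⊥ → θ.toSetoid = ⊥ ∨ ψ.toSetoid = ⊥

/-- The restriction of `h` to `S` is an embedding into `B` of the partial algebra that `A`
induces on `S`: it is injective, and it preserves every operation (fundamental or derived)
whenever arguments and value of the operation all lie in `S`. The values of `h` outside `S`
play no role. -/
structure IsPartialEmbedding {A B : Type u} [MonadicMVAlgebra A] [MonadicMVAlgebra B]
    (S : Set A) (h : A → B) : Prop where
  injOn : Set.InjOn h S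
  map_zero : (zero : A) ∈ S → h zero = zero
  map_one : (one : A) ∈ S → h one = one
  map_neg : ∀ a ∈ S, neg a ∈ S → h (neg a) = neg (h a)
  map_oplus : ∀ a ∈ S, ∀ b ∈ S, oplus a b ∈ S → h (oplus a b) = oplus (h a) (h b)
  map_prod : ∀ a ∈ S, ∀ b ∈ S, prod a b ∈ S → h (prod a b) = prod (h a) (h b)
  map_imp : ∀ a ∈ S, ∀ b ∈ S, imp a b ∈ S → h (imp a b) = imp (h a) (h b)
  map_join : ∀ a ∈ S, ∀ b ∈ S, join a b ∈ S → h (join a b) = join (h a) (h b)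
  map_meet : ∀ a ∈ S, ∀ b ∈ S, meet a b ∈ S → h (meet a b) = meet (h a) (h b)
  map_ex : ∀ a ∈ S, ex a ∈ S → h (ex a) = ex (h a)
  map_all : ∀ a ∈ S, all a ∈ S → h (all a) = all (h a)

/-- A class `K` of monadic MV-algebras has the finite embeddability property: every finite
partial subalgebra of a member of `K` embeds into a finite member of `K`. -/
def HasFEP (K : ∀ (A : Type u) [MonadicMVAlgebra A], Prop) : Prop :=
  ∀ (A : Type u) [MonadicMVAlgebra A], K A → ∀ S : Set A, S.Finite →
    ∃ (B : Type u) (_ : MonadicMVAlgebra B),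
      Finite B ∧ K B ∧ ∃ h : A → B, IsPartialEmbedding S h

/-- The class of finitely subdirectly irreducible monadic MV-algebras. -/
def MMVFSI (A : Type u) [MonadicMVAlgebra A] : Prop := IsFSI A

/-- The class (variety) of all monadic MV-algebras. -/
def MMV (A : Type u) [MonadicMVAlgebra A] : Prop := True

end MonadicMVAlgebra

/-!
Let `Q` be a prime filter of the subalgebra of constants, the common range of `ex` and `all`. For
every `x` there is a prime filter of the whole algebra that extends `Q`, contains `ex x ⇨ x` and
meets the constants exactly in `Q`; the quotient by it is an MV-chain in which `x` attains the value
of `ex x`. The MV-chains obtained for finitely many `x` are unit intervals of totally ordered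
abelian groups (Chang) which all contain the group of the chain of constants modulo `Q`. A Gordan
type theorem of the alternative yields rational functionals on these groups that agree on the
constants and are positive on any prescribed finite set of positive elements. After clearing
denominators they turn the finitely many chains into a map to a power of a finite Łukasiewicz chain,
and the chosen witnesses make the maximum over the factors equal to the value of `ex`. Every single
equation between values of the operations is thus preserved by the map as soon as sufficiently many
`x` are taken into account.

In a nontrivial finitely subdirectly irreducible algebra the filter `{1}` of the constants is itself
prime, so that one power separates all points. In general one takes a finite product of powers,
with one factor for each inequality `¬ x ≤ y` to be preserved.
-/

namespace MVAlgebra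

section Order

variable {A : Type u} [MVAlgebra A] {x y z : A}

instance (priority := 100) : Compl A := ⟨neg⟩

instance (priority := 100) : HImp A := ⟨imp⟩

instance (priority := 100) : Zero A := ⟨zero⟩

instance (priority := 100) : Add A := ⟨oplus⟩

instance (priority := 100) : One A := ⟨one⟩

instance (priority := 100) : Mul A := ⟨prod⟩

instance (priority := 100) : AddCommMonoid A where
  add_assoc := oplus_assoc
  add_comm := oplus_comm
  add_zero := oplus_zero
  zero_add x := (oplus_comm _ _).trans (oplus_zero x)
  nsmul := nsmulRec

protected theorem compl_compl (x : A) : xᶜᶜ = x := neg_neg x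

instance (priority := 100) : CommMonoid A where
  mul_assoc x y z := by
    change ((xᶜ + yᶜ)ᶜᶜ + zᶜ)ᶜ = (xᶜ + (yᶜ + zᶜ)ᶜᶜ)ᶜ
    rw [MVAlgebra.compl_compl, MVAlgebra.compl_compl, add_assoc]
  mul_comm x y := congrArg neg (oplus_comm _ _)
  one_mul x := by
    change ((0 : A)ᶜᶜ + xᶜ)ᶜ = x
    rw [MVAlgebra.compl_compl, zero_add, MVAlgebra.compl_compl]
  mul_one x := by
    change (xᶜ + (0 : A)ᶜᶜ)ᶜ = x
    rw [MVAlgebra.compl_compl, add_zero, MVAlgebra.compl_compl]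

protected theorem himp_eq (x y : A) : x ⇨ y = xᶜ + y := rfl

theorem compl_zero : (0 : A)ᶜ = 1 := rfl

theorem compl_one : (1 : A)ᶜ = 0 := neg_neg _

theorem compl_mul (x y : A) : (x * y)ᶜ = xᶜ + yᶜ := neg_neg _

theorem compl_add (x y : A) : (x + y)ᶜ = xᶜ * yᶜ := by
  rw [← MVAlgebra.compl_compl (xᶜ * yᶜ), compl_mul, MVAlgebra.compl_compl, MVAlgebra.compl_compl]

protected theorem compl_himp (x y : A) : (x ⇨ y)ᶜ = x * yᶜ := by
  rw [MVAlgebra.himp_eq, compl_add, MVAlgebra.compl_compl]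

theorem add_one_eq (x : A) : x + 1 = 1 := oplus_neg_zero x

theorem compl_add_self (x : A) : xᶜ + x = 1 := by
  have h := luk x (1 : A)
  change (xᶜ + 1)ᶜ + 1 = ((1 : A)ᶜ + x)ᶜ + x at h
  rw [add_one_eq, compl_one, zero_add] at h
  exact h.symm

theorem mul_compl_self (x : A) : x * xᶜ = 0 := by
  rw [← MVAlgebra.compl_himp, MVAlgebra.himp_eq, compl_add_self, compl_one]

theorem mul_himp (x y z : A) : x * y ⇨ z = x ⇨ y ⇨ z := by
  simp only [MVAlgebra.himp_eq, compl_mul, add_assoc]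

theorem one_himp (x : A) : 1 ⇨ x = x := by rw [MVAlgebra.himp_eq, compl_one, zero_add]

theorem himp_one (x : A) : x ⇨ 1 = 1 := add_one_eq _

theorem himp_zero (x : A) : x ⇨ 0 = xᶜ := add_zero _

protected theorem compl_himp_compl (x y : A) : yᶜ ⇨ xᶜ = x ⇨ y := by
  rw [MVAlgebra.himp_eq, MVAlgebra.himp_eq, MVAlgebra.compl_compl, add_comm]

theorem himp_himp_comm (x y : A) : (x ⇨ y) ⇨ y = (y ⇨ x) ⇨ x := luk x y

theorem add_mul_compl_of_himp_eq_one (h : x ⇨ y = 1) : x + y * xᶜ = y := by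
  rw [← MVAlgebra.compl_himp, add_comm, ← MVAlgebra.himp_eq, himp_himp_comm, h, one_himp]

instance (priority := 100) : PartialOrder A where
  le x y := x ⇨ y = 1
  le_refl := compl_add_self
  le_trans x y z hxy hyz := by
    rw [← add_mul_compl_of_himp_eq_one hyz, ← add_mul_compl_of_himp_eq_one hxy, add_assoc,
      MVAlgebra.himp_eq, ← add_assoc, compl_add_self, add_comm, add_one_eq]
  le_antisymm x y hxy hyx := by
    rw [← one_himp y, ← hxy, himp_himp_comm, hyx, one_himp]

theorem le_iff_himp_eq_one : x ≤ y ↔ x ⇨ y = 1 := Iff.rfl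

instance (priority := 100) : CanonicallyOrderedAdd A where
  exists_add_of_le h := ⟨_, (add_mul_compl_of_himp_eq_one h).symm⟩
  le_self_add x y := by
    rw [le_iff_himp_eq_one, MVAlgebra.himp_eq, ← add_assoc, compl_add_self, add_comm, add_one_eq]
  le_add_self x y := by
    rw [le_iff_himp_eq_one, MVAlgebra.himp_eq, add_left_comm, compl_add_self, add_one_eq]

instance (priority := 100) : IsOrderedAddMonoid A := CanonicallyOrderedAdd.toIsOrderedAddMonoid

protected theorem compl_le_compl_iff : yᶜ ≤ xᶜ ↔ x ≤ y := by
  rw [le_iff_himp_eq_one, MVAlgebra.compl_himp_compl, le_iff_himp_eq_one]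

instance (priority := 100) : IsOrderedMonoid A where
  mul_le_mul_left x y h z := by
    rw [← MVAlgebra.compl_le_compl_iff, compl_mul, compl_mul]
    gcongr
    exact MVAlgebra.compl_le_compl_iff.2 h

protected theorem le_one (x : A) : x ≤ 1 := himp_one x

protected theorem one_le_iff : 1 ≤ x ↔ x = 1 :=
  ⟨fun h => (MVAlgebra.le_one x).antisymm h, fun h => h.ge⟩

theorem mul_le_iff_le_himp : x * y ≤ z ↔ x ≤ y ⇨ z := by
  rw [le_iff_himp_eq_one, mul_himp, le_iff_himp_eq_one]

theorem mul_himp_le (x y : A) : x * (x ⇨ y) ≤ y := by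
  rw [mul_comm, mul_le_iff_le_himp]

protected theorem le_himp (x y : A) : y ≤ x ⇨ y := le_add_self

theorem mul_eq_zero_iff_le_compl : x * y = 0 ↔ x ≤ yᶜ := by
  rw [← himp_zero y, ← mul_le_iff_le_himp, nonpos_iff_eq_zero]

theorem add_eq_one_iff_compl_le : x + y = 1 ↔ xᶜ ≤ y := by
  rw [le_iff_himp_eq_one, MVAlgebra.himp_eq, MVAlgebra.compl_compl]

protected theorem himp_le_himp_right (h : x ≤ y) (z : A) : y ⇨ z ≤ x ⇨ z :=
  add_le_add_left (MVAlgebra.compl_le_compl_iff.2 h) z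

theorem himp_trans (x y z : A) : (x ⇨ y) * (y ⇨ z) ≤ x ⇨ z := by
  rw [← mul_le_iff_le_himp]
  calc (x ⇨ y) * (y ⇨ z) * x = x * (x ⇨ y) * (y ⇨ z) := by ac_rfl
    _ ≤ y * (y ⇨ z) := by gcongr; exact mul_himp_le x y
    _ ≤ z := mul_himp_le y z

theorem himp_le_add_himp_add (x y z : A) : x ⇨ y ≤ z + x ⇨ z + y := by
  have h : x ⇨ y ≤ (zᶜ ⇨ x) ⇨ zᶜ ⇨ y := by
    rw [← mul_le_iff_le_himp, mul_comm]
    exact himp_trans _ _ _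
  simpa only [MVAlgebra.himp_eq, MVAlgebra.compl_compl] using h

theorem join_comm (x y : A) : join x y = join y x := luk x y

theorem meet_eq_compl_join (x y : A) : meet x y = (join xᶜ yᶜ)ᶜ := by
  change x * (x ⇨ y) = _
  rw [join_comm]
  change _ = ((yᶜ ⇨ xᶜ) ⇨ xᶜ)ᶜ
  rw [MVAlgebra.compl_himp, MVAlgebra.compl_himp_compl, MVAlgebra.compl_compl, mul_comm]

theorem meet_comm (x y : A) : meet x y = meet y x := by
  rw [meet_eq_compl_join, meet_eq_compl_join, join_comm]

theorem join_le (hx : x ≤ z) (hy : y ≤ z) : join x y ≤ z := by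
  change (x ⇨ y) ⇨ y ≤ z
  calc (x ⇨ y) ⇨ y ≤ (z ⇨ y) ⇨ y :=
        MVAlgebra.himp_le_himp_right (MVAlgebra.himp_le_himp_right hx y) y
    _ = z := by rw [himp_himp_comm, le_iff_himp_eq_one.1 hy, one_himp]

instance (priority := 100) : Lattice A where
  sup := join
  inf := meet
  le_sup_left x y := (MVAlgebra.le_himp _ x).trans_eq (join_comm y x)
  le_sup_right x y := MVAlgebra.le_himp _ y
  sup_le _ _ _ := join_le
  inf_le_left x y := (meet_comm x y).trans_le (mul_himp_le y x)
  inf_le_right := mul_himp_le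
  le_inf x y z hy hz := by
    rw [meet_eq_compl_join, ← MVAlgebra.compl_le_compl_iff, MVAlgebra.compl_compl]
    exact join_le (MVAlgebra.compl_le_compl_iff.2 hy) (MVAlgebra.compl_le_compl_iff.2 hz)

protected theorem inf_eq (x y : A) : x ⊓ y = x * (x ⇨ y) := rfl

protected theorem sup_eq (x y : A) : x ⊔ y = (x ⇨ y) ⇨ y := rfl

theorem himp_sup_himp (x y : A) : (x ⇨ y) ⊔ (y ⇨ x) = 1 := by
  rw [MVAlgebra.sup_eq, ← le_iff_himp_eq_one, ← mul_le_iff_le_himp, ← mul_himp, mul_comm (x ⇨ y),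
    mul_himp, mul_comm, ← MVAlgebra.inf_eq, inf_comm, MVAlgebra.inf_eq]
  calc ((x ⇨ y) ⇨ x) * (((x ⇨ y) ⇨ x) ⇨ y) ≤ ((x ⇨ y) ⇨ x) * (x ⇨ y) := by
        gcongr
        exact MVAlgebra.himp_le_himp_right (MVAlgebra.le_himp _ x) y
    _ ≤ x := by rw [mul_comm]; exact mul_himp_le _ x

theorem pow_sup_eq_one (h : x ⊔ y = 1) (n : ℕ) : x ^ n ⊔ y = 1 := by
  have himp_eq : x ⇨ y = y := le_antisymm h (MVAlgebra.le_himp x y)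
  have pow_himp_eq : x ^ n ⇨ y = y := by
    induction n with
    | zero => rw [pow_zero, one_himp]
    | succ n ih => rw [pow_succ, mul_himp, himp_eq, ih]
  rw [MVAlgebra.sup_eq, pow_himp_eq]
  exact compl_add_self y

theorem pow_sup_pow_eq_one (h : x ⊔ y = 1) (m n : ℕ) : x ^ m ⊔ y ^ n = 1 := by
  rw [sup_comm]
  refine pow_sup_eq_one ?_ n
  rw [sup_comm]
  exact pow_sup_eq_one h m

end Order

end MVAlgebra

namespace MVAlgebra

section Hom

/-- Homomorphisms of MV-algebras. -/
structure Hom (A B : Type*) [MVAlgebra A] [MVAlgebra B] extends A →+ B where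
  map_compl' : ∀ x, toFun xᶜ = (toFun x)ᶜ

variable {A B : Type*} [MVAlgebra A] [MVAlgebra B]

namespace Hom

instance : FunLike (Hom A B) A B where
  coe f := f.toFun
  coe_injective f g h := by
    cases f
    congr
    exact DFunLike.coe_injective h

instance : AddMonoidHomClass (Hom A B) A B where
  map_zero f := f.map_zero'
  map_add f := f.map_add'

theorem map_compl (f : Hom A B) (x : A) : f xᶜ = (f x)ᶜ := f.map_compl' x

theorem map_himp (f : Hom A B) (x y : A) : f (x ⇨ y) = f x ⇨ f y := by
  rw [MVAlgebra.himp_eq, map_add, map_compl, MVAlgebra.himp_eq]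

instance : MonoidHomClass (Hom A B) A B where
  map_one f := by rw [← compl_zero, map_compl, map_zero, compl_zero]
  map_mul f x y := by
    rw [← MVAlgebra.compl_compl (x * y), compl_mul, map_compl, map_add, map_compl, map_compl,
      compl_add, MVAlgebra.compl_compl, MVAlgebra.compl_compl]

end Hom

end Hom

/-- Implicative filters: the sets `{x | x ≡ 1}` for the congruences of an MV-algebra. -/
structure ImplicativeFilter (A : Type*) [MVAlgebra A] where
  carrier : Set A
  one_mem' : 1 ∈ carrier
  mp' : ∀ {x y}, x ∈ carrier → x ⇨ y ∈ carrier → y ∈ carrier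

namespace ImplicativeFilter

variable {A : Type*} [MVAlgebra A] {F : ImplicativeFilter A} {x y : A}

instance : SetLike (ImplicativeFilter A) A where
  coe := carrier
  coe_injective F G h := by cases F; congr

instance : PartialOrder (ImplicativeFilter A) := .ofSetLike (ImplicativeFilter A) A

theorem one_mem (F : ImplicativeFilter A) : 1 ∈ F := F.one_mem'

theorem mem_of_himp_mem (hx : x ∈ F) (hxy : x ⇨ y ∈ F) : y ∈ F := F.mp' hx hxy

theorem mem_of_le (hx : x ∈ F) (hxy : x ≤ y) : y ∈ F :=
  mem_of_himp_mem hx (by rw [le_iff_himp_eq_one.1 hxy]; exact F.one_mem)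

theorem mul_mem (hx : x ∈ F) (hy : y ∈ F) : x * y ∈ F :=
  mem_of_himp_mem hy (mem_of_le hx (mul_le_iff_le_himp.1 le_rfl))

instance : Bot (ImplicativeFilter A) where
  bot :=
    { carrier := {1}
      one_mem' := rfl
      mp' := by
        rintro x y rfl hy
        rwa [one_himp] at hy }

theorem mem_bot : x ∈ (⊥ : ImplicativeFilter A) ↔ x = 1 := Iff.rfl

/-- The filter generated by a filter `F` and an element `a`. -/
def adjoin (F : ImplicativeFilter A) (a : A) : ImplicativeFilter A where
  carrier := {x | ∃ n : ℕ, a ^ n ⇨ x ∈ F}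
  one_mem' := ⟨0, by rw [himp_one]; exact F.one_mem⟩
  mp' := by
    rintro x y ⟨n, hx⟩ ⟨m, hxy⟩
    refine ⟨n + m, mem_of_le (mul_mem hx hxy) ?_⟩
    rw [← mul_le_iff_le_himp]
    calc (a ^ n ⇨ x) * (a ^ m ⇨ x ⇨ y) * a ^ (n + m)
        = a ^ n * (a ^ n ⇨ x) * (a ^ m * (a ^ m ⇨ x ⇨ y)) := by rw [pow_add]; ac_rfl
      _ ≤ x * (x ⇨ y) := mul_le_mul' (mul_himp_le _ _) (mul_himp_le _ _)
      _ ≤ y := mul_himp_le x y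

theorem le_adjoin (F : ImplicativeFilter A) (a : A) : F ≤ F.adjoin a :=
  fun _ hx => ⟨0, mem_of_le hx (MVAlgebra.le_himp _ _)⟩

theorem mem_adjoin_self (F : ImplicativeFilter A) (a : A) : a ∈ F.adjoin a :=
  ⟨1, by rw [pow_one, le_iff_himp_eq_one.1 le_rfl]; exact F.one_mem⟩

theorem mem_of_mem_adjoin_of_sup_eq_one {a b : A} (hab : a ⊔ b = 1) (ha : x ∈ F.adjoin a)
    (hb : x ∈ F.adjoin b) : x ∈ F := by
  obtain ⟨m, hm⟩ := ha
  obtain ⟨n, hn⟩ := hb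
  refine mem_of_le (mul_mem hm hn) ?_
  have hsup : a ^ m ⊔ b ^ n ≤ (a ^ m ⇨ x) * (b ^ n ⇨ x) ⇨ x := by
    refine sup_le ?_ ?_ <;> rw [← mul_le_iff_le_himp]
    · rw [← mul_assoc]
      exact (mul_le_of_le_one_right' (MVAlgebra.le_one _)).trans (mul_himp_le _ _)
    · rw [mul_left_comm]
      exact (mul_le_of_le_one_left' (MVAlgebra.le_one _)).trans (mul_himp_le _ _)
  rwa [pow_sup_pow_eq_one hab, MVAlgebra.one_le_iff] at hsup

/-- Prime filters, those with a nontrivial totally ordered quotient. -/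
class IsPrime (F : ImplicativeFilter A) : Prop where
  zero_notMem : 0 ∉ F
  himp_mem_or_himp_mem : ∀ x y, x ⇨ y ∈ F ∨ y ⇨ x ∈ F

theorem exists_coe_eq_biUnion_of_isChain {c : Set (ImplicativeFilter A)}
    (hc : IsChain (· ≤ ·) c) (hne : c.Nonempty) :
    ∃ G : ImplicativeFilter A, (G : Set A) = ⋃ F ∈ c, (F : Set A) := by
  refine ⟨⟨⋃ F ∈ c, (F : Set A), ?_, fun {x y} hx hxy => ?_⟩, rfl⟩
  · obtain ⟨F, hF⟩ := hne
    exact Set.mem_biUnion hF F.one_mem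
  · obtain ⟨F, hF, hx⟩ := Set.mem_iUnion₂.1 hx
    obtain ⟨G, hG, hxy⟩ := Set.mem_iUnion₂.1 hxy
    obtain hFG | hGF := hc.total hF hG
    · exact Set.mem_biUnion hG (mem_of_himp_mem (hFG hx) hxy)
    · exact Set.mem_biUnion hF (mem_of_himp_mem hx (hGF hxy))

theorem exists_maximal_disjoint {D : Set A} (hFD : Disjoint (F : Set A) D) :
    ∃ P, F ≤ P ∧ Maximal (fun G : ImplicativeFilter A => Disjoint (G : Set A) D) P := by
  refine zorn_le_nonempty₀ {G : ImplicativeFilter A | Disjoint (G : Set A) D} ?_ F hFD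
  intro c hcD hc G hG
  obtain ⟨U, hU⟩ := exists_coe_eq_biUnion_of_isChain hc ⟨G, hG⟩
  refine ⟨U, ?_, fun H hH => ?_⟩
  · rw [Set.mem_ofPred_eq, hU]
    exact Set.disjoint_iUnion₂_left.2 fun H hH => hcD hH
  · rw [← SetLike.coe_subset_coe, hU]
    exact Set.subset_biUnion_of_mem (u := fun H : ImplicativeFilter A => (H : Set A)) hH

theorem exists_isPrime_disjoint {D : Set A} (hD : D.Nonempty) (hFD : Disjoint (F : Set A) D)
    (hdir : ∀ c ∈ D, ∀ d ∈ D, ∃ e ∈ D, c ⇨ e ∈ F ∧ d ⇨ e ∈ F) :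
    ∃ P : ImplicativeFilter A, P.IsPrime ∧ F ≤ P ∧ Disjoint (P : Set A) D := by
  obtain ⟨P, hFP, hPD, hmax⟩ := exists_maximal_disjoint hFD
  refine ⟨P, ⟨fun h0 => ?_, fun x y => ?_⟩, hFP, hPD⟩
  · obtain ⟨d, hd⟩ := hD
    exact Set.disjoint_left.1 hPD (mem_of_le h0 zero_le) hd
  · have exists_mem_adjoin {a : A} (ha : a ∉ P) : ∃ d ∈ D, d ∈ P.adjoin a := by
      by_contra! hdisj
      have hle := hmax (Set.disjoint_right.2 hdisj) (P.le_adjoin a)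
      exact ha (hle (P.mem_adjoin_self a))
    by_contra! hxy
    obtain ⟨c, hcD, hc⟩ := exists_mem_adjoin hxy.1
    obtain ⟨d, hdD, hd⟩ := exists_mem_adjoin hxy.2
    obtain ⟨e, heD, hce, hde⟩ := hdir c hcD d hdD
    refine Set.disjoint_left.1 hPD (mem_of_mem_adjoin_of_sup_eq_one (himp_sup_himp x y) ?_ ?_) heD
    · exact mem_of_himp_mem hc (le_adjoin _ _ (hFP hce))
    · exact mem_of_himp_mem hd (le_adjoin _ _ (hFP hde))

theorem exists_isPrime_notMem (hx : x ≠ 1) : ∃ P : ImplicativeFilter A, P.IsPrime ∧ x ∉ P := by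
  obtain ⟨P, hP, -, hPx⟩ := exists_isPrime_disjoint (F := ⊥) (Set.singleton_nonempty x)
    (Set.disjoint_singleton_right.2 (mem_bot.not.2 hx)) (by
      rintro _ rfl _ rfl
      exact ⟨_, rfl, le_iff_himp_eq_one.1 le_rfl, le_iff_himp_eq_one.1 le_rfl⟩)
  exact ⟨P, hP, Set.disjoint_singleton_right.1 hPx⟩

section Quotient

/-- The congruence of the underlying MV-algebra whose class of `1` is `F`. -/
def setoid (F : ImplicativeFilter A) : Setoid A where
  r x y := x ⇨ y ∈ F ∧ y ⇨ x ∈ F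
  iseqv :=
    { refl x := and_self_iff.2 (mem_of_le F.one_mem (compl_add_self x).ge)
      symm := And.symm
      trans := fun {x y z} hxy hyz => ⟨mem_of_le (mul_mem hxy.1 hyz.1) (himp_trans x y z),
        mem_of_le (mul_mem hyz.2 hxy.2) (himp_trans z y x)⟩ }

theorem setoid_compl (h : F.setoid x y) : F.setoid xᶜ yᶜ := by
  change _ ∈ F ∧ _ ∈ F
  rw [MVAlgebra.compl_himp_compl, MVAlgebra.compl_himp_compl]
  exact h.symm

theorem setoid_add {x' y' : A} (hx : F.setoid x x') (hy : F.setoid y y') :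
    F.setoid (x + y) (x' + y') := by
  have add_left {a b : A} (z : A) (h : F.setoid a b) : F.setoid (z + a) (z + b) :=
    ⟨mem_of_le h.1 (himp_le_add_himp_add a b z), mem_of_le h.2 (himp_le_add_himp_add b a z)⟩
  refine F.setoid.trans (add_left x hy) ?_
  rw [add_comm x, add_comm x']
  exact add_left y' hx

instance : HasQuotient A (ImplicativeFilter A) := ⟨fun F => Quotient F.setoid⟩

instance : MVAlgebra (A ⧸ F) where
  oplus := Quotient.map₂ oplus fun _ _ hx _ _ hy => setoid_add hx hy
  neg := Quotient.map neg fun _ _ => setoid_compl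
  zero := Quotient.mk F.setoid 0
  oplus_assoc := by
    rintro ⟨x⟩ ⟨y⟩ ⟨z⟩
    exact congrArg (Quotient.mk F.setoid) (oplus_assoc x y z)
  oplus_comm := by
    rintro ⟨x⟩ ⟨y⟩
    exact congrArg (Quotient.mk F.setoid) (oplus_comm x y)
  oplus_zero := by
    rintro ⟨x⟩
    exact congrArg (Quotient.mk F.setoid) (oplus_zero x)
  neg_neg := by
    rintro ⟨x⟩
    exact congrArg (Quotient.mk F.setoid) (neg_neg x)
  oplus_neg_zero := by
    rintro ⟨x⟩
    exact congrArg (Quotient.mk F.setoid) (oplus_neg_zero x)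
  luk := by
    rintro ⟨x⟩ ⟨y⟩
    exact congrArg (Quotient.mk F.setoid) (luk x y)

/-- The canonical projection onto the quotient by a filter. -/
def proj (F : ImplicativeFilter A) : Hom A (A ⧸ F) where
  toFun := Quotient.mk F.setoid
  map_zero' := rfl
  map_add' _ _ := rfl
  map_compl' _ := rfl

theorem proj_surjective (F : ImplicativeFilter A) : Function.Surjective (proj F) :=
  Quotient.mk_surjective

theorem proj_eq_proj : proj F x = proj F y ↔ x ⇨ y ∈ F ∧ y ⇨ x ∈ F := Quotient.eq (r := F.setoid)

theorem proj_le_proj : proj F x ≤ proj F y ↔ x ⇨ y ∈ F := by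
  rw [le_iff_himp_eq_one, ← Hom.map_himp, ← map_one (proj F), proj_eq_proj, himp_one, one_himp]
  exact and_iff_right F.one_mem

theorem proj_eq_one : proj F x = 1 ↔ x ∈ F := by
  rw [← MVAlgebra.one_le_iff, ← map_one (proj F), proj_le_proj, one_himp]

instance [F.IsPrime] : Nontrivial (A ⧸ F) :=
  ⟨0, 1, by rw [← map_zero (proj F), ne_eq, proj_eq_one]; exact IsPrime.zero_notMem⟩

instance [F.IsPrime] : Std.Total (α := A ⧸ F) (· ≤ ·) where
  total := by
    refine (proj_surjective F).forall₂.2 fun x y => ?_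
    rw [proj_le_proj, proj_le_proj]
    exact IsPrime.himp_mem_or_himp_mem x y

variable {B : Type*} [MVAlgebra B] {Q : ImplicativeFilter B} {P : ImplicativeFilter A}

/-- The embedding of quotients induced by a homomorphism `f` and a filter `P` together with its
preimage `Q` under `f`. -/
def quotientMap (f : Hom B A) (h : ∀ b, f b ∈ P ↔ b ∈ Q) : Hom (B ⧸ Q) (A ⧸ P) where
  toFun := Quotient.map' (s₁ := Q.setoid) (s₂ := P.setoid) f fun x y hxy =>
    ⟨by rw [← f.map_himp, h]; exact hxy.1, by rw [← f.map_himp, h]; exact hxy.2⟩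
  map_zero' := congrArg (proj P) (map_zero f)
  map_add' := (proj_surjective Q).forall₂.2 fun x y => congrArg (proj P) (map_add f x y)
  map_compl' := (proj_surjective Q).forall.2 fun x => congrArg (proj P) (f.map_compl x)

theorem quotientMap_proj (f : Hom B A) (h : ∀ b, f b ∈ P ↔ b ∈ Q) (b : B) :
    quotientMap f h (proj Q b) = proj P (f b) := rfl

theorem quotientMap_injective (f : Hom B A) (h : ∀ b, f b ∈ P ↔ b ∈ Q) :
    Function.Injective (quotientMap f h) := by
  refine (proj_surjective Q).forall₂.2 fun x y hxy => ?_
  rw [quotientMap_proj, quotientMap_proj, proj_eq_proj, ← f.map_himp, ← f.map_himp, h, h] at hxy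
  exact proj_eq_proj.2 hxy

end Quotient

end ImplicativeFilter

end MVAlgebra

namespace MVAlgebra

section Chain

variable {V : Type*} [MVAlgebra V] {x y z : V}

instance [Nontrivial V] : NeZero (1 : V) where
  out h := by
    obtain ⟨x, hx⟩ := exists_ne (0 : V)
    exact hx (nonpos_iff_eq_zero.1 (h ▸ MVAlgebra.le_one x))

theorem mul_ne_one (hx : x ≠ 1) : x * y ≠ 1 := fun h =>
  hx (MVAlgebra.one_le_iff.1 (h ▸ mul_le_of_le_one_right' (MVAlgebra.le_one y)))

theorem mul_add_eq_add_mul (hxy : x + y = 1) (hyz : y + z = 1) : x * y + z = x + y * z := by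
  have hx : yᶜ + x * y = x := by
    have hle := add_eq_one_iff_compl_le.1 ((add_comm y x).trans hxy)
    simpa only [MVAlgebra.compl_compl] using add_mul_compl_of_himp_eq_one hle
  have hz : yᶜ + z * y = z := by
    have hle := add_eq_one_iff_compl_le.1 hyz
    simpa only [MVAlgebra.compl_compl] using add_mul_compl_of_himp_eq_one hle
  calc x * y + z = x * y + (yᶜ + z * y) := by rw [hz]
    _ = yᶜ + x * y + z * y := by ac_rfl
    _ = x + y * z := by rw [hx, mul_comm]

theorem add_mul_eq_mul_add (hxy : x * y = 0) (hyz : y * z = 0) : (x + y) * z = x * (y + z) := by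
  have h : xᶜ * yᶜ + zᶜ = xᶜ + yᶜ * zᶜ := by
    refine mul_add_eq_add_mul ?_ ?_
    · rw [← compl_mul, hxy, compl_zero]
    · rw [← compl_mul, hyz, compl_zero]
  simpa only [compl_add, compl_mul, MVAlgebra.compl_compl] using congrArg compl h

/-- The elements of the ordered abelian group that Chang associates with an MV-chain `V`: the
lexicographic product of `ℤ` and `V` with `(n, 1)` identified with `(n + 1, 0)`. Each class is
represented by its pair whose second entry differs from `1`. -/
@[ext]
structure Chang (V : Type*) [MVAlgebra V] where
  int : ℤ
  frac : V
  frac_ne_one : frac ≠ 1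

namespace Chang

variable {m n : ℤ} {hx : x ≠ 1} {hy : y ≠ 1} {a b c : Chang V}

noncomputable instance : Add (Chang V) where
  add a b := open Classical in
    if h : a.frac + b.frac = 1 then ⟨a.int + b.int + 1, a.frac * b.frac, mul_ne_one a.frac_ne_one⟩
    else ⟨a.int + b.int, a.frac + b.frac, h⟩

theorem mk_add_mk_of_eq (h : x + y = 1) :
    (⟨m, x, hx⟩ + ⟨n, y, hy⟩ : Chang V) = ⟨m + n + 1, x * y, mul_ne_one hx⟩ := dif_pos h

theorem mk_add_mk_of_ne (h : x + y ≠ 1) :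
    (⟨m, x, hx⟩ + ⟨n, y, hy⟩ : Chang V) = ⟨m + n, x + y, h⟩ := dif_neg h

protected theorem add_comm (a b : Chang V) : a + b = b + a := by
  obtain ⟨m, x, hx⟩ := a
  obtain ⟨n, y, hy⟩ := b
  by_cases h : x + y = 1
  · rw [mk_add_mk_of_eq h, mk_add_mk_of_eq ((add_comm y x).trans h), mk.injEq]
    exact ⟨by ring, mul_comm x y⟩
  · rw [mk_add_mk_of_ne h, mk_add_mk_of_ne (add_comm x y ▸ h), mk.injEq]
    exact ⟨add_comm m n, add_comm x y⟩

theorem add_assoc_of_eq_of_eq (hab : a.frac + b.frac = 1) (hbc : b.frac + c.frac = 1) :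
    a + b + c = a + (b + c) := by
  obtain ⟨k, x, hx⟩ := a
  obtain ⟨m, y, hy⟩ := b
  obtain ⟨n, z, hz⟩ := c
  have h_mul := mul_add_eq_add_mul hab hbc
  rw [mk_add_mk_of_eq hab, mk_add_mk_of_eq hbc]
  by_cases h : x * y + z = 1
  · rw [mk_add_mk_of_eq h, mk_add_mk_of_eq (h_mul ▸ h), mk.injEq]
    exact ⟨by ring, mul_assoc x y z⟩
  · rw [mk_add_mk_of_ne h, mk_add_mk_of_ne (h_mul ▸ h), mk.injEq]
    exact ⟨by ring, h_mul⟩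

section Nontrivial

variable [Nontrivial V]

instance : Zero (Chang V) := ⟨⟨0, 0, zero_ne_one⟩⟩

noncomputable instance : Neg (Chang V) where
  neg a := open Classical in
    if h : a.frac = 0 then ⟨-a.int, 0, zero_ne_one⟩
    else ⟨-a.int - 1, a.fracᶜ, fun h' => h (by rw [← MVAlgebra.compl_compl a.frac, h', compl_one])⟩

theorem int_neg_of_eq (h : a.frac = 0) : (-a).int = -a.int := congrArg int (dif_pos h)

theorem int_neg_of_ne (h : a.frac ≠ 0) : (-a).int = -a.int - 1 := congrArg int (dif_neg h)

protected theorem zero_add (a : Chang V) : 0 + a = a := by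
  have h : 0 + a.frac ≠ 1 := (zero_add a.frac).symm ▸ a.frac_ne_one
  exact (mk_add_mk_of_ne h).trans (Chang.ext (zero_add _) (zero_add _))

protected theorem neg_add_cancel (a : Chang V) : -a + a = 0 := by
  by_cases h : a.frac = 0
  · have hneg : -a = ⟨-a.int, 0, zero_ne_one⟩ := dif_pos h
    have h_frac : 0 + a.frac ≠ 1 := (zero_add a.frac).symm ▸ a.frac_ne_one
    rw [hneg]
    exact (mk_add_mk_of_ne h_frac).trans (Chang.ext (neg_add_cancel _) ((zero_add _).trans h))
  · have hneg : -a = ⟨-a.int - 1, a.fracᶜ, _⟩ := dif_neg h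
    rw [hneg]
    refine (mk_add_mk_of_eq (compl_add_self a.frac)).trans (Chang.ext ?_ ?_)
    · change -a.int - 1 + a.int + 1 = 0
      ring
    · exact (mul_comm _ _).trans (mul_compl_self _)

/-- The embedding of an MV-chain into its Chang group, with image the interval from `0` to the
strong unit `emb 1 = (1, 0)`. -/
noncomputable def emb (x : V) : Chang V :=
  open Classical in if h : x = 1 then ⟨1, 0, zero_ne_one⟩ else ⟨0, x, h⟩

theorem emb_one : emb (1 : V) = ⟨1, 0, zero_ne_one⟩ := dif_pos rfl

theorem emb_of_ne (hx : x ≠ 1) : emb x = ⟨0, x, hx⟩ := dif_neg hx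

theorem emb_zero : emb (0 : V) = 0 := emb_of_ne zero_ne_one

end Nontrivial

end Chang

variable [Std.Total (α := V) (· ≤ ·)]

theorem mul_eq_zero_of_add_ne_one (h : x + y ≠ 1) : x * y = 0 := by
  rw [mul_comm, mul_eq_zero_iff_le_compl]
  exact (total_of (· ≤ ·) xᶜ y).resolve_left (h ∘ add_eq_one_iff_compl_le.2)

theorem add_mul_eq_add_mul_of_ne (hxy : x + y ≠ 1) (hyz : y + z = 1) :
    (x + y) * z = x + y * z := by
  have hy : zᶜ + y * z = y := by
    have hle := add_eq_one_iff_compl_le.1 ((add_comm z y).trans hyz)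
    simpa only [MVAlgebra.compl_compl] using add_mul_compl_of_himp_eq_one hle
  have hle : x + y * z ≤ z := by
    refine (total_of (· ≤ ·) _ _).resolve_right fun h => hxy ?_
    rw [← hy, add_left_comm]
    exact h
  calc (x + y) * z = z * (z ⇨ x + y * z) := by
        rw [MVAlgebra.himp_eq, add_left_comm, hy, mul_comm]
    _ = x + y * z := by rw [← MVAlgebra.inf_eq, inf_eq_right.2 hle]

namespace Chang

variable {a b c : Chang V}

theorem add_assoc_of_ne_of_ne (hab : a.frac + b.frac ≠ 1) (hbc : b.frac + c.frac ≠ 1) :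
    a + b + c = a + (b + c) := by
  obtain ⟨k, x, hx⟩ := a
  obtain ⟨m, y, hy⟩ := b
  obtain ⟨n, z, hz⟩ := c
  rw [mk_add_mk_of_ne hab, mk_add_mk_of_ne hbc]
  by_cases h : x + y + z = 1
  · rw [mk_add_mk_of_eq h, mk_add_mk_of_eq (add_assoc x y z ▸ h), mk.injEq]
    exact ⟨by ring, add_mul_eq_mul_add (mul_eq_zero_of_add_ne_one hab)
      (mul_eq_zero_of_add_ne_one hbc)⟩
  · rw [mk_add_mk_of_ne h, mk_add_mk_of_ne (add_assoc x y z ▸ h), mk.injEq]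
    exact ⟨add_assoc k m n, add_assoc x y z⟩

theorem add_assoc_of_ne_of_eq (hab : a.frac + b.frac ≠ 1) (hbc : b.frac + c.frac = 1) :
    a + b + c = a + (b + c) := by
  obtain ⟨k, x, hx⟩ := a
  obtain ⟨m, y, hy⟩ := b
  obtain ⟨n, z, hz⟩ := c
  dsimp only at hab hbc
  have h_left : x + y + z = 1 := by rw [add_assoc, hbc, add_one_eq]
  have h_mul := add_mul_eq_add_mul_of_ne hab hbc
  have h_right : x + y * z ≠ 1 := h_mul ▸ mul_ne_one hab
  rw [mk_add_mk_of_ne hab, mk_add_mk_of_eq hbc, mk_add_mk_of_eq h_left, mk_add_mk_of_ne h_right,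
    mk.injEq]
  exact ⟨by ring, h_mul⟩

protected theorem add_assoc (a b c : Chang V) : a + b + c = a + (b + c) := by
  by_cases hab : a.frac + b.frac = 1 <;> by_cases hbc : b.frac + c.frac = 1
  · exact add_assoc_of_eq_of_eq hab hbc
  · rw [Chang.add_comm a, Chang.add_comm (b + a), Chang.add_comm b c, Chang.add_comm a]
    exact (add_assoc_of_ne_of_eq (add_comm b.frac _ ▸ hbc) (add_comm a.frac _ ▸ hab)).symm
  · exact add_assoc_of_ne_of_eq hab hbc
  · exact add_assoc_of_ne_of_ne hab hbc

variable [Nontrivial V]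

noncomputable instance : AddCommGroup (Chang V) where
  add_assoc := Chang.add_assoc
  add_comm := Chang.add_comm
  zero_add := Chang.zero_add
  add_zero a := by rw [Chang.add_comm, Chang.zero_add]
  neg_add_cancel := Chang.neg_add_cancel
  nsmul := nsmulRec
  zsmul := zsmulRec

/-- The cone of nonnegative elements, from which the order of `Chang V` is defined. -/
noncomputable def cone (V : Type*) [MVAlgebra V] [Std.Total (α := V) (· ≤ ·)] [Nontrivial V] :
    AddGroupCone (Chang V) where
  carrier := {a | 0 ≤ a.int}
  zero_mem' := le_refl (0 : ℤ)
  add_mem' := by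
    rintro ⟨m, x, hx⟩ ⟨n, y, hy⟩ (hm : 0 ≤ m) (hn : 0 ≤ n)
    rw [Set.mem_ofPred_eq]
    by_cases h : x + y = 1
    · rw [mk_add_mk_of_eq h]
      positivity
    · rw [mk_add_mk_of_ne h]
      positivity
  eq_zero_of_mem_of_neg_mem' := by
    intro a (ha : 0 ≤ a.int) (hneg : 0 ≤ (-a).int)
    by_cases h : a.frac = 0
    · rw [int_neg_of_eq h] at hneg
      exact Chang.ext (by change a.int = 0; lia) h
    · rw [int_neg_of_ne h] at hneg
      lia

theorem mem_cone : a ∈ cone V ↔ 0 ≤ a.int := Iff.rfl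

instance : HasMemOrNegMem (cone V) where
  mem_or_neg_mem a := by
    rw [mem_cone, mem_cone]
    by_cases h : a.frac = 0
    · rw [int_neg_of_eq h]
      lia
    · rw [int_neg_of_ne h]
      lia

noncomputable instance : LinearOrder (Chang V) :=
  open Classical in LinearOrder.mkOfAddGroupCone (cone V)

instance : IsOrderedAddMonoid (Chang V) := IsOrderedAddMonoid.mkOfCone (cone V)

theorem nonneg_iff : 0 ≤ a ↔ 0 ≤ a.int := by
  change a - 0 ∈ cone V ↔ _
  rw [sub_zero, mem_cone]

theorem emb_nonneg (x : V) : 0 ≤ emb x := by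
  rw [nonneg_iff]
  obtain rfl | hx := eq_or_ne x 1
  · rw [emb_one]
    exact zero_le_one
  · rw [emb_of_ne hx]

theorem emb_pos (hx : x ≠ 0) : 0 < emb x := by
  refine (emb_nonneg x).lt_of_ne' fun h => ?_
  obtain rfl | hx1 := eq_or_ne x 1
  · rw [emb_one] at h
    exact one_ne_zero (congrArg int h)
  · rw [emb_of_ne hx1] at h
    exact hx (congrArg frac h)

theorem emb_add_add_emb_mul (x y : V) : emb (x + y) + emb (x * y) = emb x + emb y := by
  obtain rfl | hx := eq_or_ne x 1
  · rw [add_comm 1 y, add_one_eq, one_mul]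
  obtain rfl | hy := eq_or_ne y 1
  · rw [add_one_eq, mul_one, add_comm]
  rw [emb_of_ne hx, emb_of_ne hy]
  by_cases h : x + y = 1
  · have h_mul : 0 + x * y ≠ 1 := (zero_add (x * y)).symm ▸ mul_ne_one hx
    rw [mk_add_mk_of_eq h, h, emb_one, emb_of_ne (mul_ne_one hx), mk_add_mk_of_ne h_mul, mk.injEq]
    exact ⟨rfl, zero_add _⟩
  · rw [mk_add_mk_of_ne h, mul_eq_zero_of_add_ne_one h, emb_zero, add_zero, emb_of_ne h, mk.injEq]
    exact ⟨rfl, rfl⟩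

section Map

variable {W : Type*} [MVAlgebra W] [Std.Total (α := W) (· ≤ ·)] [Nontrivial W] {f : Hom V W}

/-- Functoriality of the Chang group for embeddings of MV-chains. -/
noncomputable def map (f : Hom V W) (hf : Function.Injective f) : Chang V →+ Chang W where
  toFun a := ⟨a.int, f a.frac, (map_ne_one_iff f hf).2 a.frac_ne_one⟩
  map_zero' := Chang.ext rfl (map_zero f)
  map_add' := by
    rintro ⟨m, x, hx⟩ ⟨n, y, hy⟩
    by_cases h : x + y = 1
    · rw [mk_add_mk_of_eq h, mk_add_mk_of_eq (by rw [← map_add, h, map_one]), mk.injEq]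
      exact ⟨rfl, map_mul f x y⟩
    · have h_map : f x + f y ≠ 1 := by rwa [← map_add, map_ne_one_iff f hf]
      rw [mk_add_mk_of_ne h, mk_add_mk_of_ne h_map, mk.injEq]
      exact ⟨rfl, map_add f x y⟩

theorem map_nonneg_iff (hf : Function.Injective f) : 0 ≤ map f hf a ↔ 0 ≤ a := by
  rw [nonneg_iff, nonneg_iff]
  rfl

theorem map_emb (hf : Function.Injective f) (x : V) : map f hf (emb x) = emb (f x) := by
  obtain rfl | hx := eq_or_ne x 1
  · rw [map_one, emb_one, emb_one]
    exact Chang.ext rfl (map_zero f)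
  · rw [emb_of_ne hx, emb_of_ne ((map_ne_one_iff f hf).2 hx)]
    rfl

end Map

end Chang

end Chain

end MVAlgebra

section RatFunctional

variable {H : Type*} [AddCommGroup H]

theorem exists_addMonoidHom_rat_apply_eq_one {v : H} (hv : ∀ n : ℤ, n • v = 0 → n = 0) :
    ∃ χ : H →+ ℚ, χ v = 1 := by
  have hinj : Function.Injective (zmultiplesHom H v) :=
    (injective_iff_map_eq_zero _).2 fun n hn => hv n (by rwa [zmultiplesHom_apply] at hn)
  obtain ⟨χ, hχ⟩ := (Module.Baer.of_divisible ℚ).extension_property_addMonoidHom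
    (zmultiplesHom H v) hinj (Int.castAddHom ℚ)
  exact ⟨χ, by simpa using DFunLike.congr_fun hχ 1⟩

theorem exists_addMonoidHom_rat_pos_of_quotient {κ : Type*} {s : Finset κ} {v : κ → H} {u : H}
    (hu : ∀ n : ℤ, n • u = 0 → n = 0) (ψ : H ⧸ AddSubgroup.zmultiples u →+ ℚ)
    (hψ : ∀ k ∈ s, 0 < ψ (v k)) : ∃ φ : H →+ ℚ, 0 < φ u ∧ ∀ k ∈ s, 0 < φ (v k) := by
  obtain ⟨χ, hχ⟩ := exists_addMonoidHom_rat_apply_eq_one hu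
  obtain ⟨N, hN⟩ : ∃ N : ℕ, ∀ k ∈ s, 0 < N * ψ (v k) + χ (v k) := by
    refine ((Filter.eventually_all_finset s).2 fun k hk => ?_).exists (f := Filter.atTop)
    have htendsto := tendsto_natCast_atTop_atTop.atTop_mul_const (hψ k hk)
    filter_upwards [htendsto.eventually_gt_atTop (-χ (v k))] with N hN
    linarith
  refine ⟨N • ψ.comp (QuotientAddGroup.mk' _) + χ, ?_, fun k hk => by simpa using hN k hk⟩
  have hu0 : (u : H ⧸ AddSubgroup.zmultiples u) = 0 :=
    (QuotientAddGroup.eq_zero_iff u).2 (AddSubgroup.mem_zmultiples u)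
  simp [hu0, hχ]

theorem neg_mk_notMem_closure {κ : Type*} {s : Set κ} {v : κ → H} {u : H}
    (hv : ∀ k ∈ s, -v k ∉ AddSubmonoid.closure (insert u (v '' s))) {φ : H →+ ℚ}
    (hφ : ∀ k ∈ s, 0 < φ (v k)) (hu : φ u ≤ 0) :
    ∀ k ∈ s, -(v k : H ⧸ AddSubgroup.zmultiples u) ∉
      AddSubmonoid.closure ((fun k => (v k : H ⧸ AddSubgroup.zmultiples u)) '' s) := by
  intro k hk hmem
  have himage : (fun k => (v k : H ⧸ AddSubgroup.zmultiples u)) '' s =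
      QuotientAddGroup.mk' (AddSubgroup.zmultiples u) '' (v '' s) := (Set.image_image ..).symm
  rw [himage, ← AddMonoidHom.map_mclosure] at hmem
  obtain ⟨w, hw, hwk⟩ := hmem
  obtain ⟨m, hm : m • u = v k + w⟩ : v k + w ∈ AddSubgroup.zmultiples u := by
    rw [← QuotientAddGroup.eq_zero_iff, QuotientAddGroup.mk_add]
    exact (congrArg _ hwk).trans (add_neg_cancel _)
  have hφw : 0 ≤ φ w := by
    have hle : AddSubmonoid.closure (v '' s) ≤ (AddSubmonoid.nonneg ℚ).comap φ :=
      AddSubmonoid.closure_le.2 (Set.forall_mem_image.2 fun k hk => (hφ k hk).le)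
    exact hle hw
  have hm_neg : m < 0 := by
    by_contra! hm0
    have hle : φ (m • u) ≤ 0 := by
      rw [map_zsmul, zsmul_eq_mul]
      exact mul_nonpos_of_nonneg_of_nonpos (Int.cast_nonneg hm0) hu
    rw [hm, map_add] at hle
    linarith [hφ k hk]
  refine hv k hk ?_
  have hneg : -v k = w + m.natAbs • u := by
    rw [← natCast_zsmul, Int.ofNat_natAbs_of_nonpos hm_neg.le, neg_zsmul, hm]
    abel
  rw [hneg]
  exact add_mem (AddSubmonoid.closure_mono (Set.subset_insert _ _) hw)
    (nsmul_mem (AddSubmonoid.subset_closure (Set.mem_insert _ _)) _)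

/-- Gordan's theorem of the alternative. If the functional found for `s` is not positive at `v a`,
one found on the quotient by `v a` is perturbed by a functional with value `1` at `v a`. -/
theorem exists_addMonoidHom_rat_pos {κ : Type*} (s : Finset κ) (v : κ → H)
    (hv : ∀ k ∈ s, -v k ∉ AddSubmonoid.closure (v '' s)) :
    ∃ φ : H →+ ℚ, ∀ k ∈ s, 0 < φ (v k) := by
  classical
  induction s using Finset.induction_on generalizing H with
  | empty => exact ⟨0, by simp⟩
  | insert a s _ ih =>
    rw [Finset.coe_insert, Set.image_insert_eq] at hv
    obtain ⟨hva, hvs⟩ := (Finset.forall_mem_insert ..).1 hv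
    obtain ⟨φ, hφ⟩ := ih v fun k hk hmem =>
      hvs k hk (AddSubmonoid.closure_mono (Set.subset_insert _ _) hmem)
    obtain hpos | hnonpos := lt_or_ge 0 (φ (v a))
    · exact ⟨φ, (Finset.forall_mem_insert ..).2 ⟨hpos, hφ⟩⟩
    obtain ⟨ψ, hψ⟩ := ih _ (neg_mk_notMem_closure hvs hφ hnonpos)
    have hva_order : ∀ n : ℤ, n • v a = 0 → n = 0 := by
      intro n hn
      by_contra hn0
      obtain ⟨m, hm⟩ := Nat.exists_eq_succ_of_ne_zero (Int.natAbs_ne_zero.2 hn0)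
      have hm_smul : m • v a + v a = 0 := by
        rw [← succ_nsmul, ← Nat.succ_eq_add_one, ← hm]
        exact natAbs_nsmul_eq_zero.2 hn
      refine hva ?_
      rw [← eq_neg_of_add_eq_zero_left hm_smul]
      exact nsmul_mem (AddSubmonoid.subset_closure (Set.mem_insert _ _)) m
    obtain ⟨φ, hφ⟩ := exists_addMonoidHom_rat_pos_of_quotient hva_order ψ hψ
    exact ⟨φ, (Finset.forall_mem_insert ..).2 hφ⟩

theorem exists_pos_natCast_mul_eq_natCast {κ : Type*} (s : Finset κ) {q : κ → ℚ}
    (hq : ∀ k ∈ s, 0 ≤ q k) : ∃ N : ℕ, 0 < N ∧ ∀ k ∈ s, ∃ m : ℕ, N * q k = m := by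
  refine ⟨∏ k ∈ s, (q k).den, Finset.prod_pos fun k _ => (q k).den_pos, fun k hk => ?_⟩
  obtain ⟨r, hr⟩ := Finset.dvd_prod_of_mem (fun k => (q k).den) hk
  refine ⟨r * (q k).num.toNat, ?_⟩
  have hnum : ((q k).num.toNat : ℚ) = (q k).num := by
    exact_mod_cast Int.toNat_of_nonneg (Rat.num_nonneg.2 (hq k hk))
  rw [hr, Nat.cast_mul, Nat.cast_mul, hnum, ← Rat.mul_den_eq_num]
  ring

variable [PartialOrder H] [IsOrderedAddMonoid H]

theorem exists_addMonoidHom_rat_natCast {κ : Type*} (N : AddSubgroup H)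
    (hN : ∀ h ∈ N, 0 ≤ h → h = 0) (s : Finset κ) {v : κ → H} (hv : ∀ k ∈ s, 0 ≤ v k) :
    ∃ φ : H →+ ℚ, (∀ h ∈ N, φ h = 0) ∧
      ∀ k ∈ s, (∃ m : ℕ, φ (v k) = m) ∧ (0 < v k → 0 < φ (v k)) := by
  classical
  have hclosure : ∀ k ∈ s.filter fun k => 0 < v k, -(v k : H ⧸ N) ∉
      AddSubmonoid.closure ((fun k => (v k : H ⧸ N)) '' (s.filter fun k => 0 < v k)) := by
    intro k hk hmem
    have hpos : 0 < v k := (Finset.mem_filter.1 hk).2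
    have himage : (fun k => (v k : H ⧸ N)) '' (s.filter fun k => 0 < v k) =
        QuotientAddGroup.mk' N '' (v '' (s.filter fun k => 0 < v k)) := (Set.image_image ..).symm
    rw [himage, ← AddMonoidHom.map_mclosure] at hmem
    obtain ⟨w, hw, hwk⟩ := hmem
    have hw_nonneg : 0 ≤ w := by
      have hle : AddSubmonoid.closure (v '' (s.filter fun k => 0 < v k)) ≤ AddSubmonoid.nonneg H :=
        AddSubmonoid.closure_le.2
          (Set.forall_mem_image.2 fun k hk => hv k (Finset.mem_filter.1 hk).1)
      exact hle hw
    refine (add_pos_of_pos_of_nonneg hpos hw_nonneg).ne' (hN _ ?_ (by positivity))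
    rw [← QuotientAddGroup.eq_zero_iff, QuotientAddGroup.mk_add]
    exact (congrArg _ hwk).trans (add_neg_cancel _)
  obtain ⟨ψ, hψ⟩ := exists_addMonoidHom_rat_pos _ _ hclosure
  have hψ_nonneg : ∀ k ∈ s, 0 ≤ ψ (v k) := fun k hk => by
    obtain hpos | hzero := (hv k hk).lt_or_eq
    · exact (hψ k (Finset.mem_filter.2 ⟨hk, hpos⟩)).le
    · rw [← hzero, QuotientAddGroup.mk_zero, map_zero]
  obtain ⟨n, hn, hnat⟩ := exists_pos_natCast_mul_eq_natCast s hψ_nonneg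
  refine ⟨n • ψ.comp (QuotientAddGroup.mk' N), fun h hh => ?_, fun k hk => ⟨?_, fun hpos => ?_⟩⟩
  · simp [(QuotientAddGroup.eq_zero_iff h).2 hh]
  · simpa using hnat k hk
  · simpa using mul_pos (Nat.cast_pos.2 hn) (hψ k (Finset.mem_filter.2 ⟨hk, hpos⟩))

/-- The functionals come from one functional on `D × ∏ i, G i` that vanishes on the elements
`(-∑ i, d i, fun i => J i (d i))`, so that all the copies of `D` are identified. -/
theorem exists_addMonoidHom_rat_amalgam {X D : Type*} {G : X → Type*} [Finite X]
    [AddCommGroup D] [PartialOrder D] [IsOrderedAddMonoid D]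
    [∀ i, AddCommGroup (G i)] [∀ i, PartialOrder (G i)] [∀ i, IsOrderedAddMonoid (G i)]
    (J : ∀ i, D →+ G i) (hJ : ∀ i d, 0 ≤ J i d → 0 ≤ d)
    (s : Finset (Σ i, G i)) (hs : ∀ k ∈ s, 0 ≤ k.2) :
    ∃ (φ₀ : D →+ ℚ) (φ : ∀ i, G i →+ ℚ), (∀ i d, φ i (J i d) = φ₀ d) ∧
      ∀ k ∈ s, (∃ m : ℕ, φ k.1 k.2 = m) ∧ (0 < k.2 → 0 < φ k.1 k.2) := by
  classical
  cases nonempty_fintype X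
  let ι : (X → D) →+ D × ∀ i, G i :=
    { toFun d := (-∑ i, d i, fun i => J i (d i))
      map_zero' := by ext <;> simp
      map_add' d e := by ext <;> simp [Finset.sum_add_distrib, add_comm] }
  have hι : ∀ h ∈ ι.range, 0 ≤ h → h = 0 := by
    rintro _ ⟨d, rfl⟩ ⟨hsum, hJd⟩
    have hd : ∀ i ∈ Finset.univ, 0 ≤ d i := fun i _ => hJ i (d i) (hJd i)
    have hd_sum : ∑ i, d i = 0 := le_antisymm (neg_nonneg.1 hsum) (Finset.sum_nonneg hd)
    have hd_zero : d = 0 := funext fun i =>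
      (Finset.sum_eq_zero_iff_of_nonneg hd).1 hd_sum i (Finset.mem_univ i)
    rw [hd_zero, map_zero]
  obtain ⟨φ, hφι, hφ⟩ := exists_addMonoidHom_rat_natCast ι.range hι s
    (v := fun k => (0, Pi.single k.1 k.2)) fun k hk => ⟨le_rfl, Pi.single_nonneg.2 (hs k hk)⟩
  refine ⟨φ.comp (AddMonoidHom.inl _ _),
    fun i => (φ.comp (AddMonoidHom.inr _ _)).comp (AddMonoidHom.single G i), fun i d => ?_,
    fun k hk => ⟨(hφ k hk).1, fun hpos => (hφ k hk).2 ?_⟩⟩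
  · have hι_single : ι (Pi.single i d) = (0, Pi.single i (J i d)) - (d, 0) := by
      ext j
      · simp [ι]
      · simpa [ι] using Pi.apply_single (fun j => J j) (fun j => map_zero _) i d j
    have hzero := hφι _ ⟨_, hι_single⟩
    rw [map_sub] at hzero
    exact sub_eq_zero.1 hzero
  · exact Prod.lt_iff.2 (.inr ⟨le_rfl, Pi.single_pos.2 hpos⟩)

end RatFunctional

namespace MonadicMVAlgebra

open MVAlgebra MVAlgebra.ImplicativeFilter

section Quantifiers

variable {A : Type u} [MonadicMVAlgebra A] {c d x y : A}

theorem all_le (x : A) : all x ≤ x := all_imp_self x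

theorem all_himp_all (x y : A) : all (x ⇨ all y) = ex x ⇨ all y := all_imp_all x y

theorem all_all_himp (x y : A) : all (all x ⇨ y) = all x ⇨ all y := all_all_imp x y

theorem all_one : all (1 : A) = 1 := by
  have h := all_all_himp (1 : A) 1
  rwa [le_iff_himp_eq_one.1 (all_le 1), le_iff_himp_eq_one.1 le_rfl] at h

theorem all_zero : all (0 : A) = 0 := nonpos_iff_eq_zero.1 (all_le 0)

theorem all_compl (x : A) : all xᶜ = (ex x)ᶜ := by
  have h := all_himp_all x 0
  rwa [all_zero, himp_zero, himp_zero] at h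

theorem ex_eq_compl_all_compl (x : A) : ex x = (all xᶜ)ᶜ := by
  rw [all_compl, MVAlgebra.compl_compl]

theorem ex_compl (x : A) : ex xᶜ = (all x)ᶜ := by
  rw [ex_eq_compl_all_compl, MVAlgebra.compl_compl]

theorem all_eq_compl_ex_compl (x : A) : all x = (ex xᶜ)ᶜ := by
  rw [ex_compl, MVAlgebra.compl_compl]

theorem le_ex (x : A) : x ≤ ex x := by
  have h := all_le xᶜ
  rwa [all_compl, MVAlgebra.compl_le_compl_iff] at h

theorem ex_one : ex (1 : A) = 1 := MVAlgebra.one_le_iff.1 (le_ex 1)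

theorem all_all (x : A) : all (all x) = all x := by
  have h := all_himp_all 1 x
  rwa [ex_one, one_himp] at h

theorem ex_all (x : A) : ex (all x) = all x := by
  refine le_antisymm ?_ (le_ex _)
  rw [le_iff_himp_eq_one, ← all_himp_all, le_iff_himp_eq_one.1 le_rfl, all_one]

theorem ex_zero : ex (0 : A) = 0 := by rw [← all_zero, ex_all]

theorem all_ex (x : A) : all (ex x) = ex x := by rw [ex_eq_compl_all_compl, all_compl, ex_all]

theorem all_mono (h : x ≤ y) : all x ≤ all y := by
  rw [le_iff_himp_eq_one, ← all_all_himp, le_iff_himp_eq_one.1 ((all_le x).trans h), all_one]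

theorem ex_mono (h : x ≤ y) : ex x ≤ ex y := by
  rw [← MVAlgebra.compl_le_compl_iff, ← all_compl, ← all_compl]
  exact all_mono (MVAlgebra.compl_le_compl_iff.2 h)

theorem all_himp_le (x y : A) : all (x ⇨ y) ≤ all x ⇨ all y := by
  rw [← all_all_himp]
  exact all_mono (MVAlgebra.himp_le_himp_right (all_le x) y)

theorem all_compl_of_all_eq (hc : all c = c) : all cᶜ = cᶜ := by
  rw [all_compl, ← hc, ex_all]

theorem all_add_of_all_eq (hc : all c = c) (hd : all d = d) : all (c + d) = c + d := by
  have h := all_all_himp cᶜ d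
  rwa [all_compl_of_all_eq hc, hd, MVAlgebra.himp_eq, MVAlgebra.compl_compl] at h

theorem all_mul_of_all_eq (hc : all c = c) (x : A) : all (c * x) = c * all x := by
  have hsup (z : A) : join cᶜ z = c ⇨ c * z := by
    rw [join_comm]
    change (z ⇨ cᶜ) ⇨ cᶜ = c ⇨ c * z
    rw [← MVAlgebra.compl_himp_compl, MVAlgebra.compl_compl, MVAlgebra.compl_himp,
      MVAlgebra.compl_compl, mul_comm]
  have hjoin : all (c ⇨ c * x) = c ⇨ c * all x := by
    have h := all_ex_join cᶜ x
    rwa [ex_compl, hc, hsup, hsup] at h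
  have himp : all (c ⇨ c * x) = c ⇨ all (c * x) := by
    have h := all_all_himp c (c * x)
    rwa [hc] at h
  calc all (c * x) = c ⊓ all (c * x) := (inf_eq_right.2 ((all_le _).trans
        (mul_le_of_le_one_right' (MVAlgebra.le_one x)))).symm
    _ = c ⊓ (c * all x) := by rw [MVAlgebra.inf_eq, MVAlgebra.inf_eq, ← himp, hjoin]
    _ = c * all x := inf_eq_right.2 (mul_le_of_le_one_right' (MVAlgebra.le_one _))

theorem all_pow_of_all_eq (hc : all c = c) (n : ℕ) : all (c ^ n) = c ^ n := by
  induction n with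
  | zero => rw [pow_zero, all_one]
  | succ n ih => rw [pow_succ', all_mul_of_all_eq hc, ih]

theorem ex_ex_himp (x : A) : ex (ex x ⇨ x) = 1 := by
  rw [ex_eq_compl_all_compl, MVAlgebra.compl_himp, all_mul_of_all_eq (all_ex x), all_compl,
    mul_compl_self, compl_zero]

theorem ex_pow_eq_one (hx : ex x = 1) (n : ℕ) : ex (x ^ n) = 1 := by
  have hpow_two (k : ℕ) : ex (x ^ 2 ^ k) = 1 := by
    induction k with
    | zero => rwa [pow_zero, pow_one]
    | succ k ih =>
      have h : ex (x ^ 2 ^ k * x ^ 2 ^ k) = ex (x ^ 2 ^ k) * ex (x ^ 2 ^ k) := ex_prod_self _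
      rw [pow_succ, mul_two, pow_add, h, ih, mul_one]
  refine MVAlgebra.one_le_iff.1 ((hpow_two n).ge.trans (ex_mono ?_))
  exact pow_le_pow_right_of_le_one' (MVAlgebra.le_one x) n.lt_two_pow_self.le

end Quantifiers

/-- The subalgebra of constants of a monadic MV-algebra, which is the common range of the two
quantifiers. -/
def Constants (A : Type u) [MonadicMVAlgebra A] : Type u := {c : A // all c = c}

namespace Constants

variable {A : Type u} [MonadicMVAlgebra A] {x y : A}

instance : MVAlgebra (Constants A) where
  oplus c d := ⟨c.1 + d.1, all_add_of_all_eq c.2 d.2⟩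
  neg c := ⟨c.1ᶜ, all_compl_of_all_eq c.2⟩
  zero := ⟨0, all_zero⟩
  oplus_assoc _ _ _ := Subtype.ext (oplus_assoc _ _ _)
  oplus_comm _ _ := Subtype.ext (oplus_comm _ _)
  oplus_zero _ := Subtype.ext (oplus_zero _)
  neg_neg _ := Subtype.ext (neg_neg _)
  oplus_neg_zero _ := Subtype.ext (oplus_neg_zero _)
  luk _ _ := Subtype.ext (luk _ _)

/-- The inclusion of the constants. -/
def val (A : Type u) [MonadicMVAlgebra A] : Hom (Constants A) A where
  toFun c := c.1
  map_zero' := rfl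
  map_add' _ _ := rfl
  map_compl' _ := rfl

theorem val_injective : Function.Injective (val A) := Subtype.val_injective

/-- The universal quantifier with values in the constants. -/
def ofAll (x : A) : Constants A := ⟨all x, all_all x⟩

theorem val_ofAll (x : A) : val A (ofAll x) = all x := rfl

theorem ofAll_val (c : Constants A) : ofAll (val A c) = c := Subtype.ext c.2

theorem le_of_ofAll_himp_eq_one (h : ofAll (x ⇨ y) = 1) : x ≤ y := by
  refine le_iff_himp_eq_one.2 (MVAlgebra.one_le_iff.1 ?_)
  exact (congrArg (val A) h).ge.trans (all_le _)

/-- The filter of `A` generated by a filter of constants. -/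
def generatedFilter (Q : ImplicativeFilter (Constants A)) : ImplicativeFilter A where
  carrier := {x | ofAll x ∈ Q}
  one_mem' := by
    have h : ofAll (1 : A) = 1 := Subtype.ext all_one
    rw [Set.mem_ofPred_eq, h]
    exact Q.one_mem
  mp' {x y} hx hxy := by
    have h : ofAll (x ⇨ y) ≤ ofAll x ⇨ ofAll y := Subtype.ext (all_himp_le x y)
    exact Q.mem_of_himp_mem hx (Q.mem_of_le hxy h)

variable {Q : ImplicativeFilter (Constants A)}

theorem mem_generatedFilter : x ∈ generatedFilter Q ↔ ofAll x ∈ Q := Iff.rfl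

/-- For `u = ex x ⇨ x` the constant `all (u ^ n ⇨ val A c)` is `ex (u ^ n) ⇨ val A c = val A c`. -/
theorem val_mem_adjoin_ex_himp_iff {c : Constants A} :
    val A c ∈ (generatedFilter Q).adjoin (ex x ⇨ x) ↔ c ∈ Q := by
  have hc (n : ℕ) : ofAll ((ex x ⇨ x) ^ n ⇨ val A c) = c := by
    refine val_injective ?_
    have h := all_himp_all ((ex x ⇨ x) ^ n) (val A c)
    rw [ex_pow_eq_one (ex_ex_himp x), one_himp, ← val_ofAll (val A c), ofAll_val] at h
    exact h
  refine ⟨fun ⟨n, hn⟩ => ?_, fun h => ⟨0, ?_⟩⟩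
  · rwa [mem_generatedFilter, hc] at hn
  · rwa [mem_generatedFilter, hc]

theorem exists_isPrime_ex_himp_mem (Q : ImplicativeFilter (Constants A)) [hQ : Q.IsPrime] (x : A) :
    ∃ P : ImplicativeFilter A, P.IsPrime ∧ (∀ c, val A c ∈ P ↔ c ∈ Q) ∧ ex x ⇨ x ∈ P := by
  let F := (generatedFilter Q).adjoin (ex x ⇨ x)
  have hval {c : Constants A} : val A c ∈ F ↔ c ∈ Q := val_mem_adjoin_ex_himp_iff
  have hdisj : Disjoint (F : Set A) (val A '' {c | c ∉ Q}) := by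
    rw [Set.disjoint_right, Set.forall_mem_image]
    exact fun c hc hcF => hc (hval.1 hcF)
  have hdir : ∀ y ∈ val A '' {c | c ∉ Q}, ∀ z ∈ val A '' {c | c ∉ Q},
      ∃ e ∈ val A '' {c | c ∉ Q}, y ⇨ e ∈ F ∧ z ⇨ e ∈ F := by
    have himp {c d : Constants A} : val A c ⇨ val A d ∈ F ↔ c ⇨ d ∈ Q := by
      rw [← Hom.map_himp, hval]
    have hself (c : Constants A) : c ⇨ c ∈ Q := le_iff_himp_eq_one.1 (le_refl c) ▸ Q.one_mem
    rintro _ ⟨c, hc, rfl⟩ _ ⟨d, hd, rfl⟩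
    obtain h | h := hQ.himp_mem_or_himp_mem c d
    · exact ⟨_, ⟨d, hd, rfl⟩, himp.2 h, himp.2 (hself d)⟩
    · exact ⟨_, ⟨c, hc, rfl⟩, himp.2 (hself c), himp.2 h⟩
  obtain ⟨P, hP, hFP, hPD⟩ :=
    F.exists_isPrime_disjoint (Set.Nonempty.image _ ⟨0, hQ.zero_notMem⟩) hdisj hdir
  refine ⟨P, hP, fun c => ⟨fun hcP => ?_, fun hc => hFP (hval.2 hc)⟩, hFP (mem_adjoin_self ..)⟩
  by_contra hc
  exact Set.disjoint_left.1 hPD hcP ⟨c, hc, rfl⟩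

end Constants

section FSI

variable {A : Type u} [MonadicMVAlgebra A]

/-- The congruence of a monadic MV-algebra determined by a filter closed under `all`. -/
def Congruence.ofFilter (F : ImplicativeFilter A) (hF : ∀ x ∈ F, all x ∈ F) : Congruence A :=
  have all_congr {x y : A} (h : F.setoid x y) : F.setoid (all x) (all y) :=
    ⟨F.mem_of_le (hF _ h.1) (all_himp_le _ _), F.mem_of_le (hF _ h.2) (all_himp_le _ _)⟩
  { F.setoid with
    oplus_congr := F.setoid_add
    neg_congr := F.setoid_compl
    all_congr := all_congr
    ex_congr := fun {a b} h => by
      rw [ex_eq_compl_all_compl a, ex_eq_compl_all_compl b]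
      exact F.setoid_compl (all_congr (F.setoid_compl h)) }

theorem all_mem_adjoin_bot {c x : A} (hc : all c = c)
    (hx : x ∈ (⊥ : ImplicativeFilter A).adjoin c) : all x ∈ (⊥ : ImplicativeFilter A).adjoin c := by
  obtain ⟨n, hn⟩ := hx
  refine ⟨n, mem_bot.2 (le_iff_himp_eq_one.1 ?_)⟩
  rw [← all_pow_of_all_eq hc]
  exact all_mono (le_iff_himp_eq_one.2 (mem_bot.1 hn))

theorem IsFSI.isPrime_bot [Nontrivial A] (hA : IsFSI A) :
    (⊥ : ImplicativeFilter (Constants A)).IsPrime where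
  zero_notMem h := zero_ne_one (congrArg (Constants.val A) (mem_bot.1 h))
  himp_mem_or_himp_mem c d := by
    let θ (c : Constants A) : Congruence A :=
      .ofFilter ((⊥ : ImplicativeFilter A).adjoin c.1) fun _ => all_mem_adjoin_bot c.2
    have eq_one_of_eq_bot (c : Constants A) (hc : (θ c).toSetoid = ⊥) : c = 1 := by
      have h : (θ c).toSetoid c.1 1 := by
        refine ⟨?_, ?_⟩
        · rw [himp_one]
          exact one_mem _
        · rw [one_himp]
          exact mem_adjoin_self _ _
      rw [hc] at h
      exact Subtype.ext h
    have hsup : (c ⇨ d).1 ⊔ (d ⇨ c).1 = 1 := himp_sup_himp c.1 d.1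
    have hinf : (θ (c ⇨ d)).toSetoid ⊓ (θ (d ⇨ c)).toSetoid = ⊥ := by
      refine le_bot_iff.1 fun x y hxy => ?_
      obtain ⟨hcd, hdc⟩ := Setoid.inf_iff_and.1 hxy
      exact le_antisymm (mem_of_mem_adjoin_of_sup_eq_one hsup hcd.1 hdc.1)
        (mem_of_mem_adjoin_of_sup_eq_one hsup hcd.2 hdc.2)
    exact (hA _ _ hinf).imp (eq_one_of_eq_bot _) (eq_one_of_eq_bot _)

theorem Congruence.rel_mul_compl_zero {θ : Congruence A} {a b : A} (h : θ.toSetoid a b) :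
    θ.toSetoid (a * bᶜ) 0 := by
  rw [← MVAlgebra.compl_himp, ← compl_one, ← le_iff_himp_eq_one.1 (le_refl b)]
  exact θ.neg_congr (θ.oplus_congr (θ.neg_congr h) (θ.refl b))

theorem Congruence.exists_ne_zero_rel_zero {θ : Congruence A} (hθ : θ.toSetoid ≠ ⊥) :
    ∃ c : A, c ≠ 0 ∧ θ.toSetoid c 0 := by
  contrapose! hθ
  refine le_bot_iff.1 fun a b hab => ?_
  have le_of_rel {a b : A} (hab : θ.toSetoid a b) : a ≤ b := by
    by_contra hle
    refine hθ _ ?_ (rel_mul_compl_zero hab)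
    rwa [Ne, mul_eq_zero_iff_le_compl, MVAlgebra.compl_compl]
  exact le_antisymm (le_of_rel hab) (le_of_rel (θ.symm hab))

theorem Congruence.eq_top_of_ne_bot (hA : ∀ c : A, c ≠ 0 → ∃ n : ℕ, n • ex c = 1)
    {θ : Congruence A} (hθ : θ.toSetoid ≠ ⊥) : θ.toSetoid = ⊤ := by
  obtain ⟨c, hc, hc0⟩ := θ.exists_ne_zero_rel_zero hθ
  obtain ⟨n, hn⟩ := hA c hc
  have hex : θ.toSetoid (ex c) 0 := by
    have h : θ.toSetoid (ex c) (ex 0) := θ.ex_congr hc0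
    rwa [ex_zero] at h
  have hsmul (m : ℕ) : θ.toSetoid (m • ex c) 0 := by
    induction m with
    | zero => rw [zero_smul]
    | succ m ih =>
      rw [succ_nsmul, ← add_zero (0 : A)]
      exact θ.oplus_congr ih hex
  have hone : θ.toSetoid 1 0 := hn ▸ hsmul n
  have rel_one (x : A) : θ.toSetoid x 1 := by
    have h := θ.oplus_congr (θ.refl x) (θ.symm hone)
    change θ.toSetoid (x + 0) (x + 1) at h
    rwa [add_zero, add_one_eq] at h
  exact top_le_iff.1 fun x y _ => θ.trans (rel_one x) (θ.symm (rel_one y))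

theorem IsFSI.of_forall_exists_nsmul_ex (hA : ∀ c : A, c ≠ 0 → ∃ n : ℕ, n • ex c = 1) :
    IsFSI A := by
  intro θ ψ hinf
  by_contra! hne
  rw [Congruence.eq_top_of_ne_bot hA hne.1, top_inf_eq] at hinf
  exact hne.2 hinf

end FSI

end MonadicMVAlgebra

/-- The power `Ł_n ^ X` of the Łukasiewicz chain with `n + 1` elements, which is represented as
`{0, …, n}` with unit `n`. -/
@[ext]
structure LukasiewiczPower (X : Type*) (n : ℕ) where
  val : X → ℕ
  val_le : ∀ i, val i ≤ n

namespace LukasiewiczPower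

open MVAlgebra MonadicMVAlgebra

variable {X : Type u} {n : ℕ}

instance : MVAlgebra (LukasiewiczPower X n) where
  oplus f g := ⟨fun i => min n (f.val i + g.val i), fun _ => min_le_left _ _⟩
  neg f := ⟨fun i => n - f.val i, fun _ => Nat.sub_le _ _⟩
  zero := ⟨fun _ => 0, fun _ => Nat.zero_le _⟩
  oplus_assoc f g h := by ext i; grind
  oplus_comm f g := by ext i; grind
  oplus_zero f := by ext i; grind [f.val_le i]
  neg_neg f := by ext i; grind [f.val_le i]
  oplus_neg_zero f := by ext i; grind
  luk f g := by ext i; grind [f.val_le i, g.val_le i]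

theorem val_zero (i : X) : (0 : LukasiewiczPower X n).val i = 0 := rfl

theorem val_one (i : X) : (1 : LukasiewiczPower X n).val i = n := rfl

theorem val_compl (f : LukasiewiczPower X n) (i : X) : fᶜ.val i = n - f.val i := rfl

theorem val_add (f g : LukasiewiczPower X n) (i : X) :
    (f + g).val i = min n (f.val i + g.val i) := rfl

theorem val_himp (f g : LukasiewiczPower X n) (i : X) :
    (f ⇨ g).val i = min n (n - f.val i + g.val i) := rfl

theorem val_mul (f g : LukasiewiczPower X n) (i : X) :
    (f * g).val i = f.val i + g.val i - n := by
  rw [← MVAlgebra.compl_compl (f * g), compl_mul, val_compl, val_add, val_compl, val_compl]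
  have := f.val_le i
  have := g.val_le i
  lia

theorem val_sup (f g : LukasiewiczPower X n) (i : X) :
    (f ⊔ g).val i = max (f.val i) (g.val i) := by
  rw [MVAlgebra.sup_eq, val_himp, val_himp]
  have := f.val_le i
  have := g.val_le i
  lia

theorem val_nsmul (m : ℕ) (f : LukasiewiczPower X n) (i : X) :
    (m • f).val i = min n (m * f.val i) := by
  induction m with
  | zero => rw [zero_smul, val_zero, zero_mul, min_eq_right (Nat.zero_le _)]
  | succ m ih =>
    rw [succ_nsmul, val_add, ih, add_one_mul]
    lia

instance [Finite X] : Finite (LukasiewiczPower X n) :=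
  have : Finite (Set.Iic n) := Set.finite_Iic n
  .of_injective (fun f i => (⟨f.val i, f.val_le i⟩ : Set.Iic n)) fun _ _ h =>
    LukasiewiczPower.ext (funext fun i => congrArg Subtype.val (congrFun h i))

/-- The maximum of `f`, as a constant function. -/
noncomputable def constMax (f : LukasiewiczPower X n) : LukasiewiczPower X n :=
  ⟨fun _ => ⨆ i, f.val i, fun _ => ciSup_le' f.val_le⟩

/-- The minimum of `f`, as a constant function. -/
noncomputable def constMin (f : LukasiewiczPower X n) : LukasiewiczPower X n :=
  ⟨fun _ => ⨅ i, f.val i, fun j => (ciInf_le' f.val j).trans (f.val_le j)⟩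

theorem isGreatest_val_constMax (f : LukasiewiczPower X n) (j : X) :
    IsGreatest (Set.range f.val) (f.constMax.val j) := by
  have hbdd : BddAbove (Set.range f.val) := ⟨n, Set.forall_mem_range.2 f.val_le⟩
  have : Nonempty X := ⟨j⟩
  exact ⟨Nat.sSup_mem (Set.range_nonempty _) hbdd, fun _ => le_csSup hbdd⟩

theorem isLeast_val_constMin (f : LukasiewiczPower X n) (j : X) :
    IsLeast (Set.range f.val) (f.constMin.val j) := by
  have : Nonempty X := ⟨j⟩
  exact ⟨Nat.sInf_mem (Set.range_nonempty _), fun _ => Nat.sInf_le⟩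

variable {f g : LukasiewiczPower X n} {φ : ℕ → ℕ}

theorem val_constMax_of_monotone (hφ : Monotone φ) (hg : ∀ i, g.val i = φ (f.val i)) (i : X) :
    g.constMax.val i = φ (f.constMax.val i) := by
  have h := hφ.map_isGreatest (isGreatest_val_constMax f i)
  rw [← Set.range_comp, ← (funext hg : g.val = φ ∘ f.val)] at h
  exact (isGreatest_val_constMax g i).unique h

theorem val_constMin_of_monotone (hφ : Monotone φ) (hg : ∀ i, g.val i = φ (f.val i)) (i : X) :
    g.constMin.val i = φ (f.constMin.val i) := by
  have h := hφ.map_isLeast (isLeast_val_constMin f i)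
  rw [← Set.range_comp, ← (funext hg : g.val = φ ∘ f.val)] at h
  exact (isLeast_val_constMin g i).unique h

theorem val_constMin_of_antitone (hφ : Antitone φ) (hg : ∀ i, g.val i = φ (f.val i)) (i : X) :
    g.constMin.val i = φ (f.constMax.val i) := by
  have h := hφ.map_isGreatest (isGreatest_val_constMax f i)
  rw [← Set.range_comp, ← (funext hg : g.val = φ ∘ f.val)] at h
  exact (isLeast_val_constMin g i).unique h

noncomputable instance : MonadicMVAlgebra (LukasiewiczPower X n) where
  ex := constMax
  all := constMin
  all_imp_self f := by
    ext i
    change (f.constMin ⇨ f).val i = n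
    rw [val_himp]
    have := (isLeast_val_constMin f i).2 (Set.mem_range_self i)
    lia
  all_imp_all f g := by
    ext i
    exact val_constMin_of_antitone (f := f) (φ := fun t => min n (n - t + g.constMin.val i))
      (fun _ _ _ => by lia) (fun _ => rfl) i
  all_all_imp f g := by
    ext i
    exact val_constMin_of_monotone (f := g) (φ := fun t => min n (n - f.constMin.val i + t))
      (fun _ _ _ => by lia) (fun _ => rfl) i
  all_ex_join f g := by
    ext i
    have h := val_constMin_of_monotone (f := g) (g := f.constMax ⊔ g)
      (φ := fun t => max (f.constMax.val i) t) (fun _ _ _ => by lia) (fun j => val_sup _ g j) i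
    exact h.trans (val_sup f.constMax g.constMin i).symm
  ex_prod_self f := by
    ext i
    have h := val_constMax_of_monotone (f := f) (g := f * f) (φ := fun t => t + t - n)
      (fun _ _ _ => by lia) (val_mul f f) i
    exact h.trans (val_mul f.constMax f.constMax i).symm

theorem isGreatest_val_ex (f : LukasiewiczPower X n) (i : X) :
    IsGreatest (Set.range f.val) ((ex f).val i) := isGreatest_val_constMax f i

theorem isFSI (X : Type u) (n : ℕ) : IsFSI (LukasiewiczPower X n) := by
  refine IsFSI.of_forall_exists_nsmul_ex fun f hf => ⟨n, LukasiewiczPower.ext (funext fun i => ?_)⟩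
  obtain ⟨j, hj⟩ : ∃ j, f.val j ≠ 0 := by
    by_contra! hzero
    exact hf (LukasiewiczPower.ext (funext hzero))
  have hpos : 0 < (ex f).val i :=
    (Nat.pos_of_ne_zero hj).trans_le ((isGreatest_val_ex f i).2 (Set.mem_range_self j))
  rw [val_nsmul, val_one]
  exact min_eq_left (Nat.le_mul_of_pos_right n hpos)

end LukasiewiczPower

namespace MonadicMVAlgebra

section Pi

open MVAlgebra

variable {I : Type u} {B : I → Type u} [∀ i, MonadicMVAlgebra (B i)]

instance : MonadicMVAlgebra (∀ i, B i) where
  oplus f g := fun i => oplus (f i) (g i)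
  neg f := fun i => neg (f i)
  zero := fun _ => zero
  oplus_assoc _ _ _ := funext fun _ => oplus_assoc _ _ _
  oplus_comm _ _ := funext fun _ => oplus_comm _ _
  oplus_zero _ := funext fun _ => oplus_zero _
  neg_neg _ := funext fun _ => neg_neg _
  oplus_neg_zero _ := funext fun _ => oplus_neg_zero _
  luk _ _ := funext fun _ => luk _ _
  ex f := fun i => ex (f i)
  all f := fun i => all (f i)
  all_imp_self _ := funext fun _ => all_imp_self _
  all_imp_all _ _ := funext fun _ => all_imp_all _ _
  all_all_imp _ _ := funext fun _ => all_all_imp _ _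
  all_ex_join _ _ := funext fun _ => all_ex_join _ _
  ex_prod_self _ := funext fun _ => ex_prod_self _

end Pi

end MonadicMVAlgebra

namespace MonadicMVAlgebra

open MVAlgebra Filter

/-- A family of maps which along `l` respects each single instance of the operations, in other
words which induces a homomorphism into the reduced product of the `B i` modulo `l`. The
quantifier `all` is left out because it is determined by `ex`. -/
structure IsEventualHom {ι : Type*} (l : Filter ι) {A : Type u} {B : ι → Type u}
    [MonadicMVAlgebra A] [∀ i, MonadicMVAlgebra (B i)] (h : ∀ i, A → B i) : Prop where
  map_zero : ∀ᶠ i in l, h i 0 = 0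
  map_compl : ∀ x, ∀ᶠ i in l, h i xᶜ = (h i x)ᶜ
  map_add : ∀ x y, ∀ᶠ i in l, h i (x + y) = h i x + h i y
  map_ex : ∀ x, ∀ᶠ i in l, h i (ex x) = ex (h i x)

namespace IsEventualHom

variable {ι : Type*} {l : Filter ι} {A : Type u} [MonadicMVAlgebra A]

section Single

variable {B : ι → Type u} [∀ i, MonadicMVAlgebra (B i)] {h : ∀ i, A → B i}

theorem map_one (hh : IsEventualHom l h) : ∀ᶠ i in l, h i 1 = 1 := by
  filter_upwards [hh.map_zero, hh.map_compl 0] with i hzero hcompl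
  rw [← compl_zero, hcompl, hzero, compl_zero]

theorem map_mul (hh : IsEventualHom l h) (x y : A) : ∀ᶠ i in l, h i (x * y) = h i x * h i y := by
  filter_upwards [hh.map_compl x, hh.map_compl y, hh.map_add xᶜ yᶜ, hh.map_compl (xᶜ + yᶜ)]
    with i hx hy hadd hcompl
  change h i (xᶜ + yᶜ)ᶜ = ((h i x)ᶜ + (h i y)ᶜ)ᶜ
  rw [hcompl, hadd, hx, hy]

theorem map_himp (hh : IsEventualHom l h) (x y : A) :
    ∀ᶠ i in l, h i (x ⇨ y) = h i x ⇨ h i y := by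
  filter_upwards [hh.map_compl x, hh.map_add xᶜ y] with i hx hadd
  rw [MVAlgebra.himp_eq, hadd, hx, MVAlgebra.himp_eq]

theorem map_sup (hh : IsEventualHom l h) (x y : A) : ∀ᶠ i in l, h i (x ⊔ y) = h i x ⊔ h i y := by
  filter_upwards [hh.map_himp x y, hh.map_himp (x ⇨ y) y] with i hxy hsup
  rw [MVAlgebra.sup_eq, hsup, hxy, MVAlgebra.sup_eq]

theorem map_inf (hh : IsEventualHom l h) (x y : A) : ∀ᶠ i in l, h i (x ⊓ y) = h i x ⊓ h i y := by
  filter_upwards [hh.map_himp x y, hh.map_mul x (x ⇨ y)] with i hxy hinf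
  rw [MVAlgebra.inf_eq, hinf, hxy, MVAlgebra.inf_eq]

theorem map_all (hh : IsEventualHom l h) (x : A) : ∀ᶠ i in l, h i (all x) = all (h i x) := by
  filter_upwards [hh.map_compl x, hh.map_ex xᶜ, hh.map_compl (ex xᶜ)] with i hx hex hcompl
  rw [all_eq_compl_ex_compl, hcompl, hex, hx, all_eq_compl_ex_compl]

theorem eventually_isPartialEmbedding (hh : IsEventualHom l h) {S : Set A} (hS : S.Finite)
    (hinj : ∀ x ∈ S, ∀ y ∈ S, ¬ x ≤ y → ∀ᶠ i in l, h i x ≠ h i y) :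
    ∀ᶠ i in l, IsPartialEmbedding S (h i) := by
  have forall_mem {p : A → ι → Prop} (hp : ∀ x ∈ S, ∀ᶠ i in l, p x i) :
      ∀ᶠ i in l, ∀ x ∈ S, p x i := (eventually_all_finite hS).2 hp
  have forall_mem₂ {p : A → A → ι → Prop} (hp : ∀ x ∈ S, ∀ y ∈ S, ∀ᶠ i in l, p x y i) :
      ∀ᶠ i in l, ∀ x ∈ S, ∀ y ∈ S, p x y i := forall_mem fun x hx => forall_mem (hp x hx)
  have hinj' := forall_mem₂ fun x hx y hy => eventually_imp_distrib_left.2 (hinj x hx y hy)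
  filter_upwards [hinj', hh.map_zero, hh.map_one, forall_mem fun x _ => hh.map_compl x,
    forall_mem₂ fun x _ y _ => hh.map_add x y, forall_mem₂ fun x _ y _ => hh.map_mul x y,
    forall_mem₂ fun x _ y _ => hh.map_himp x y, forall_mem₂ fun x _ y _ => hh.map_sup x y,
    forall_mem₂ fun x _ y _ => hh.map_inf x y, forall_mem fun x _ => hh.map_ex x,
    forall_mem fun x _ => hh.map_all x]
    with i hinj hzero hone hcompl hadd hmul himp hsup hinf hex hall
  exact
    { injOn := fun x hx y hy hxy => le_antisymm (not_imp_not.1 (hinj x hx y hy) hxy)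
        (not_imp_not.1 (hinj y hy x hx) hxy.symm)
      map_zero := fun _ => hzero
      map_one := fun _ => hone
      map_neg := fun x hx _ => hcompl x hx
      map_oplus := fun x hx y hy _ => hadd x hx y hy
      map_prod := fun x hx y hy _ => hmul x hx y hy
      map_imp := fun x hx y hy _ => himp x hx y hy
      map_join := fun x hx y hy _ => hsup x hx y hy
      map_meet := fun x hx y hy _ => hinf x hx y hy
      map_ex := fun x hx _ => hex x hx
      map_all := fun x hx _ => hall x hx }

end Single

theorem pi {I : Type u} [Finite I] {B : ι → I → Type u} [∀ i p, MonadicMVAlgebra (B i p)]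
    {h : ∀ i p, A → B i p} (hh : ∀ p, IsEventualHom l fun i => h i p) :
    IsEventualHom l fun i x p => h i p x where
  map_zero := (eventually_all.2 fun p => (hh p).map_zero).mono fun _ => funext
  map_compl x := (eventually_all.2 fun p => (hh p).map_compl x).mono fun _ => funext
  map_add x y := (eventually_all.2 fun p => (hh p).map_add x y).mono fun _ => funext
  map_ex x := (eventually_all.2 fun p => (hh p).map_ex x).mono fun _ => funext

end IsEventualHom

end MonadicMVAlgebra

namespace MVAlgebra

/-- Rational valuations of an MV-algebra that factor through a totally ordered quotient `V`, being
the restriction to `V` of a homomorphism from the ordered group in which `V` is the interval from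
`0` to `1`. No positivity is required. -/
structure IsChainValuation {A : Type*} [MVAlgebra A] (r : A → ℚ) : Prop where
  map_zero : r 0 = 0
  map_add_add_map_mul : ∀ x y, r (x + y) + r (x * y) = r x + r y
  map_mul_eq_zero_or : ∀ x y, r (x * y) = 0 ∨ r (x + y) = r 1

namespace IsChainValuation

variable {A : Type*} [MVAlgebra A] {r : A → ℚ} {x y : A}

theorem comp_emb {V : Type*} [MVAlgebra V] [Std.Total (α := V) (· ≤ ·)] [Nontrivial V]
    (f : Hom A V) (φ : Chang V →+ ℚ) : IsChainValuation fun x => φ (Chang.emb (f x)) where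
  map_zero := by rw [_root_.map_zero, Chang.emb_zero, _root_.map_zero]
  map_add_add_map_mul x y := by
    rw [map_add, map_mul, ← map_add, Chang.emb_add_add_emb_mul, map_add]
  map_mul_eq_zero_or x y := by
    by_cases h : f x + f y = 1
    · rw [map_add f, h, map_one]
      exact .inr rfl
    · rw [map_mul, mul_eq_zero_of_add_ne_one h, Chang.emb_zero, _root_.map_zero]
      exact .inl rfl

theorem map_compl (hr : IsChainValuation r) (x : A) : r xᶜ = r 1 - r x := by
  have h := hr.map_add_add_map_mul x xᶜ
  rw [add_comm x, compl_add_self, mul_compl_self, hr.map_zero] at h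
  linarith

theorem map_add_eq_min (hr : IsChainValuation r) (hmul : 0 ≤ r (x * y))
    (hcompl : 0 ≤ r (x + y)ᶜ) : r (x + y) = min (r 1) (r x + r y) := by
  rw [hr.map_compl] at hcompl
  have hadd := hr.map_add_add_map_mul x y
  obtain h | h := hr.map_mul_eq_zero_or x y
  · rw [min_eq_right] <;> linarith
  · rw [min_eq_left] <;> linarith

theorem le_of_le (hr : IsChainValuation r) (hxy : x ≤ y) (hmul : 0 ≤ r (y * xᶜ)) : r x ≤ r y := by
  have hadd := hr.map_add_add_map_mul y xᶜ
  rw [add_comm y xᶜ, ← MVAlgebra.himp_eq, le_iff_himp_eq_one.1 hxy, hr.map_compl] at hadd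
  linarith

theorem lt_of_mul_compl_pos (hr : IsChainValuation r) (hmul : 0 < r (x * yᶜ)) : r y < r x := by
  have hadd := hr.map_add_add_map_mul x yᶜ
  rw [(hr.map_mul_eq_zero_or x yᶜ).resolve_left hmul.ne', hr.map_compl] at hadd
  linarith

end IsChainValuation

end MVAlgebra

namespace MonadicMVAlgebra

open MVAlgebra MVAlgebra.ImplicativeFilter Constants Filter

/-- Valuations indexed by a finite set `T`, all with the same values at the constants, such that
the valuation with index `i` attains the value of `ex i` at `i`. They are integral and positive only
on `T`, and positivity at `i` depends on the filter `Q` of constants. -/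
structure WitnessedFamily {A : Type u} [MonadicMVAlgebra A] (Q : ImplicativeFilter (Constants A))
    (T : Finset A) where
  val : T → A → ℚ
  const : Constants A → ℚ
  isChainValuation : ∀ i, IsChainValuation (val i)
  val_const : ∀ i c, val i (Constants.val A c) = const c
  val_ex : ∀ i, val i (ex i) = val i i
  exists_val_eq_natCast : ∀ i, ∀ t ∈ T, ∃ m : ℕ, val i t = m
  val_pos : ∀ i : T, ofAll (i : A)ᶜ ∉ Q → 0 < val i i

namespace WitnessedFamily

variable {A : Type u} [MonadicMVAlgebra A] {Q : ImplicativeFilter (Constants A)} {T : Finset A}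

theorem proj_ne_zero_of_ofAll_compl_notMem {P : ImplicativeFilter A}
    (hPQ : ∀ c, Constants.val A c ∈ P ↔ c ∈ Q) {x : A} (hx : ofAll xᶜ ∉ Q)
    (hex : proj P (ex x) = proj P x) : proj P x ≠ 0 := by
  intro h0
  refine hx ((hPQ _).1 ?_)
  rw [val_ofAll, all_compl, ← proj_eq_one, Hom.map_compl, hex, h0, compl_zero]

protected theorem nonempty (Q : ImplicativeFilter (Constants A)) [Q.IsPrime] (T : Finset A) :
    Nonempty (WitnessedFamily Q T) := by
  classical
  choose P hP hPQ hPex using fun i : T => exists_isPrime_ex_himp_mem Q i.1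
  let J (i : T) : Hom (Constants A ⧸ Q) (A ⧸ P i) := quotientMap (Constants.val A) (hPQ i)
  have hJ (i : T) : Function.Injective (J i) := quotientMap_injective _ _
  let γ (i : T) (x : A) : Chang (A ⧸ P i) := Chang.emb (proj (P i) x)
  obtain ⟨φ₀, φ, hφ₀, hφ⟩ := exists_addMonoidHom_rat_amalgam (fun i => Chang.map (J i) (hJ i))
    (fun i _ => (Chang.map_nonneg_iff (hJ i)).1)
    ((Finset.univ ×ˢ T).image fun p : T × A => ⟨p.1, γ p.1 p.2⟩)
    (by
      rw [Finset.forall_mem_image]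
      exact fun p _ => Chang.emb_nonneg _)
  have hT (i : T) {t : A} (ht : t ∈ T) := hφ ⟨i, γ i t⟩
    (Finset.mem_image_of_mem _ (Finset.mk_mem_product (Finset.mem_univ i) ht))
  have hex (i : T) : proj (P i) (ex i) = proj (P i) i := proj_eq_proj.2
    ⟨hPex i, le_iff_himp_eq_one.1 (le_ex i.1) ▸ one_mem _⟩
  exact
    ⟨{  val := fun i x => φ i (γ i x)
        const := fun c => φ₀ (Chang.emb (proj Q c))
        isChainValuation := fun i => .comp_emb _ _
        val_const := fun i c => by
          rw [← hφ₀ i, Chang.map_emb, quotientMap_proj]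
        val_ex := fun i => congrArg (fun v => φ i (Chang.emb v)) (hex i)
        exists_val_eq_natCast := fun i t ht => (hT i ht).1
        val_pos := fun i hi => (hT i i.2).2
          (Chang.emb_pos (proj_ne_zero_of_ofAll_compl_notMem (hPQ i) hi (hex i))) }⟩

theorem val_ex_eq_val_ex (W : WitnessedFamily Q T) (i j : T) (x : A) :
    W.val i (ex x) = W.val j (ex x) := by
  rw [← all_ex, ← val_ofAll, W.val_const, W.val_const]

/-- The valuations of a family, truncated to maps into a finite Łukasiewicz chain. -/
noncomputable def toPower (W : WitnessedFamily Q T) (x : A) : LukasiewiczPower T ⌊W.const 1⌋₊ :=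
  ⟨fun i => min ⌊W.const 1⌋₊ ⌊W.val i x⌋₊, fun _ => min_le_left _ _⟩

theorem natCast_floor_const_one (W : WitnessedFamily Q T) (h1 : 1 ∈ T) (i : T) :
    (⌊W.const 1⌋₊ : ℚ) = W.val i 1 := by
  obtain ⟨n, hn⟩ := W.exists_val_eq_natCast i 1 h1
  have hconst : W.val i 1 = W.const 1 := W.val_const i 1
  rw [← hconst, hn, Nat.floor_natCast]

theorem natCast_val_toPower (W : WitnessedFamily Q T) (h1 : 1 ∈ T) {x : A} (hx : x ∈ T)
    (hxc : xᶜ ∈ T) (i : T) : ((W.toPower x).val i : ℚ) = W.val i x := by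
  obtain ⟨m, hm⟩ := W.exists_val_eq_natCast i x hx
  obtain ⟨k, hk⟩ := W.exists_val_eq_natCast i xᶜ hxc
  have hle : m ≤ ⌊W.const 1⌋₊ := by
    rw [(W.isChainValuation i).map_compl, ← W.natCast_floor_const_one h1, hm,
      sub_eq_iff_eq_add] at hk
    exact_mod_cast hk.symm ▸ le_add_of_nonneg_left k.cast_nonneg
  change ((min ⌊W.const 1⌋₊ ⌊W.val i x⌋₊ : ℕ) : ℚ) = W.val i x
  rw [hm, Nat.floor_natCast, min_eq_right hle]

section Eventually

variable (W : ∀ T, WitnessedFamily Q T)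

theorem eventually_natCast_val_toPower (x : A) :
    ∀ᶠ T in atTop, ∀ i, (((W T).toPower x).val i : ℚ) = (W T).val i x := by
  classical
  filter_upwards [eventually_ge_atTop {1, x, xᶜ}] with T hT
  exact (W T).natCast_val_toPower (hT (by simp)) (hT (by simp)) (hT (by simp))

theorem eventually_natCast_floor_const_one :
    ∀ᶠ T in atTop, ∀ i, (⌊(W T).const 1⌋₊ : ℚ) = (W T).val i 1 := by
  filter_upwards [eventually_ge_atTop {1}] with T hT
  exact (W T).natCast_floor_const_one (hT (Finset.mem_singleton_self _))

theorem eventually_toPower_compl (x : A) :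
    ∀ᶠ T in atTop, (W T).toPower xᶜ = ((W T).toPower x)ᶜ := by
  filter_upwards [eventually_natCast_val_toPower W x, eventually_natCast_val_toPower W xᶜ,
    eventually_natCast_floor_const_one W] with T hx hxc hone
  ext i
  have h := ((W T).isChainValuation i).map_compl x
  rw [← hx, ← hxc, ← hone, ← Nat.cast_sub (((W T).toPower x).val_le i), Nat.cast_inj] at h
  rwa [LukasiewiczPower.val_compl]

theorem eventually_toPower_add (x y : A) :
    ∀ᶠ T in atTop, (W T).toPower (x + y) = (W T).toPower x + (W T).toPower y := by
  filter_upwards [eventually_natCast_val_toPower W x, eventually_natCast_val_toPower W y,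
    eventually_natCast_val_toPower W (x + y), eventually_natCast_val_toPower W (x + y)ᶜ,
    eventually_natCast_val_toPower W (x * y), eventually_natCast_floor_const_one W]
    with T hx hy hadd hcompl hmul hone
  ext i
  have h := ((W T).isChainValuation i).map_add_eq_min (x := x) (y := y)
    (hmul i ▸ Nat.cast_nonneg _) (hcompl i ▸ Nat.cast_nonneg _)
  rw [← hx, ← hy, ← hadd, ← hone] at h
  rw [LukasiewiczPower.val_add]
  exact_mod_cast h

theorem eventually_toPower_ex (x : A) :
    ∀ᶠ T in atTop, (W T).toPower (ex x) = ex ((W T).toPower x) := by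
  filter_upwards [eventually_natCast_val_toPower W x, eventually_natCast_val_toPower W (ex x),
    eventually_natCast_val_toPower W (ex x * xᶜ), eventually_ge_atTop {x}]
    with T hx hex hmul hT
  ext i
  have hgreatest : IsGreatest (Set.range ((W T).toPower x).val) (((W T).toPower (ex x)).val i) := by
    let k : T := ⟨x, hT (Finset.mem_singleton_self x)⟩
    refine ⟨⟨k, ?_⟩, ?_⟩
    · rw [← Nat.cast_inj (R := ℚ), hx, hex, (W T).val_ex_eq_val_ex i k, (W T).val_ex]
    · rintro _ ⟨j, rfl⟩
      rw [← Nat.cast_le (α := ℚ), hx, hex, (W T).val_ex_eq_val_ex i j]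
      exact ((W T).isChainValuation j).le_of_le (le_ex x) (hmul j ▸ Nat.cast_nonneg _)
  exact hgreatest.unique (LukasiewiczPower.isGreatest_val_ex _ i)

theorem isEventualHom_toPower : IsEventualHom atTop fun T => (W T).toPower where
  map_zero := by
    filter_upwards [eventually_natCast_val_toPower W 0] with T hzero
    ext i
    rw [← Nat.cast_inj (R := ℚ), hzero, ((W T).isChainValuation i).map_zero,
      LukasiewiczPower.val_zero, Nat.cast_zero]
  map_compl := eventually_toPower_compl W
  map_add := eventually_toPower_add W
  map_ex := eventually_toPower_ex W

theorem eventually_toPower_ne {x y : A} (hxy : ofAll (x ⇨ y) ∉ Q) :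
    ∀ᶠ T in atTop, (W T).toPower x ≠ (W T).toPower y := by
  filter_upwards [eventually_natCast_val_toPower W x, eventually_natCast_val_toPower W y,
    eventually_ge_atTop {x * yᶜ}] with T hx hy hT heq
  let i : T := ⟨x * yᶜ, hT (Finset.mem_singleton_self _)⟩
  have hpos : 0 < (W T).val i (x * yᶜ) := (W T).val_pos i (by
    change ofAll (x * yᶜ)ᶜ ∉ Q
    rwa [← MVAlgebra.compl_himp, MVAlgebra.compl_compl])
  have hlt := ((W T).isChainValuation i).lt_of_mul_compl_pos hpos
  rw [← hx, ← hy, heq] at hlt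
  exact hlt.false

end Eventually

end WitnessedFamily

end MonadicMVAlgebra

namespace MonadicMVAlgebra

open MVAlgebra MVAlgebra.ImplicativeFilter Constants Filter

theorem isPartialEmbedding_id {A : Type u} [MonadicMVAlgebra A] (S : Set A) :
    IsPartialEmbedding S (id : A → A) := by
  constructor <;> intros <;> first | rfl | exact Set.injOn_id S

theorem hasFEP_MMVFSI : HasFEP.{u} (fun A [MonadicMVAlgebra A] => MMVFSI A) := by
  intro A _ hA S hS
  obtain _ | _ := subsingleton_or_nontrivial A
  · exact ⟨A, inferInstance, inferInstance, hA, id, isPartialEmbedding_id S⟩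
  have := IsFSI.isPrime_bot hA
  have W (T : Finset A) := (WitnessedFamily.nonempty (⊥ : ImplicativeFilter (Constants A)) T).some
  obtain ⟨T, hT⟩ := ((WitnessedFamily.isEventualHom_toPower W).eventually_isPartialEmbedding hS
    fun x _ y _ hxy => WitnessedFamily.eventually_toPower_ne W
      (mem_bot.not.2 (mt le_of_ofAll_himp_eq_one hxy))).exists
  exact ⟨_, inferInstance, inferInstance, LukasiewiczPower.isFSI _ _, _, hT⟩

theorem hasFEP_MMV : HasFEP.{u} (fun A [MonadicMVAlgebra A] => MMV A) := by
  intro A _ _ S hS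
  let I := {p : A × A // p ∈ S ×ˢ S ∧ ¬ p.1 ≤ p.2}
  have : Finite I := (hS.prod hS).subset fun _ hp => hp.1
  choose Q hQ hQI using fun p : I =>
    exists_isPrime_notMem (mt le_of_ofAll_himp_eq_one p.2.2)
  have W (p : I) (T : Finset A) := (WitnessedFamily.nonempty (Q p) T).some
  have hinj (x : A) (hx : x ∈ S) (y : A) (hy : y ∈ S) (hxy : ¬ x ≤ y) :
      ∀ᶠ T in atTop, (fun p => (W p T).toPower x) ≠ fun p => (W p T).toPower y :=
    let p : I := ⟨(x, y), ⟨hx, hy⟩, hxy⟩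
    (WitnessedFamily.eventually_toPower_ne (W p) (hQI p)).mono fun _ h heq => h (congrFun heq p)
  obtain ⟨T, hT⟩ := ((IsEventualHom.pi fun p => WitnessedFamily.isEventualHom_toPower
    (W p)).eventually_isPartialEmbedding hS hinj).exists
  exact ⟨_, inferInstance, inferInstance, trivial, _, hT⟩

end MonadicMVAlgebra

theorem mainTheorem5 :
    MonadicMVAlgebra.HasFEP.{u} (fun A [MonadicMVAlgebra A] => MonadicMVAlgebra.MMVFSI A) ∧
      MonadicMVAlgebra.HasFEP.{u} (fun A [MonadicMVAlgebra A] => MonadicMVAlgebra.MMV A) :=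
  ⟨MonadicMVAlgebra.hasFEP_MMVFSI, MonadicMVAlgebra.hasFEP_MMV⟩
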